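/- Let $\mathbf k$ be a field of characteristic zero; all vector spaces are finite-dimensional and $\mathbb Z/2$-graded, $\Pi$ denotes parity reversion and $\operatorname{Tr}$ the supertrace (trace on the even part minus trace on the odd part). For a dg vector space $(V,d)$ let $\hat S\,\Pi V^*$ be the completed free graded-commutative algebra on $\Pi V^*$, and let $\operatorname{Der}_{\ge 2}(\hat S\,\Pi V^*)$ be its derivations that send $\Pi V^*$ to series without terms of order $<2$. An $L_\infty$ structure on $V$ is an odd $m\in \operatorname{Der}_{\ge 2}(\hat S\,\Pi V^*)$ with $[d,m]+\tfrac12[m,m]=0$; equivalently it is given by symmetric multilinear maps $\tilde m_n\colon(\Pi V)^{\otimes n}\to\Pi V$, $n\ge2$. The divergence of $\xi=\sum_i f_i\partial_{x_i}$ is $\nabla\xi=\sum_i(-1)^{|f_i||x_i|}\partial_{x_i}f_i$, where $x_1,x_2,\dots$ is a homogeneous basis of $\Pi V^*$. A unimodular lift of $m$ is an even $f\in\hat S\,\Pi V^*$ with $d(f)+\tfrac12\nabla(m)+m(f)=0$; the $L_\infty$ algebra $(V,m)$ is strictly unimodular if $f=0$ is a unimodular lift, that is, if $\nabla(m)=0$.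 A unital graded-commutative dg algebra (cdga) $A$ is unimodular if $\operatorname{Tr}(x\mapsto ax)=0$ for every $a\in A$. Let $A$ be a cdga and let $(V,m)$ be an $L_\infty$ algebra. Then there is exactly one $L_\infty$ structure on the dg vector space $A\otimes V$ whose multilinear maps are $$(a_1\otimes v_1,\dots,a_n\otimes v_n)\mapsto \pm\, a_1\cdots a_n\otimes\tilde m_n(v_1,\dots,v_n)$$ (with the sign of the Koszul rule), and for $A\otimes V$ with this structure: 1. $A\otimes V$ is strictly unimodular if and only if $V$ is strictly unimodular or $A$ is unimodular. 2. $A\otimes V$ admits a unimodular lift if and only if $V$ admits a unimodular lift or $A$ is unimodular. -/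

import Mathlib

open scoped TensorProduct

noncomputable section

namespace SuperLInfty

/-! ### Signs and dg super vector spaces -/

/-- The sign `(-1)^i` for `i ∈ ℤ/2`. -/
def sgn (k : Type*) [Field k] (i : ZMod 2) : k := if i = 0 then 1 else -1

/-- The structure of a differential `ℤ/2`-graded vector space on `V`: a splitting into an even part
`part 0` and an odd part `part 1`, and an odd operator `d` of square zero. -/
structure DGSpace (k V : Type*) [Field k] [AddCommGroup V] [Module k V] where
  part : ZMod 2 → Submodule k V
  isCompl : IsCompl (part 0) (part 1)
  d : V →ₗ[k] V
  d_mem : ∀ i, ∀ v ∈ part i, d v ∈ part (i + 1)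
  d_d : ∀ v, d (d v) = 0

section Space

variable {k V : Type*} [Field k] [AddCommGroup V] [Module k V]

theorem zmod_two_cases (i : ZMod 2) : i = 0 ∨ i = 1 := by
  revert i; decide

theorem DGSpace.isCompl_part (𝒱 : DGSpace k V) (i : ZMod 2) :
    IsCompl (𝒱.part i) (𝒱.part (i + 1)) := by
  rcases zmod_two_cases i with rfl | rfl
  · simpa using 𝒱.isCompl
  · have h : (1 + 1 : ZMod 2) = 0 := by decide
    rw [h]; exact 𝒱.isCompl.symm

/-- The projection of `V` onto its component of parity `i`, along the other component. -/
def DGSpace.projOnto (𝒱 : DGSpace k V) (i : ZMod 2) : V →ₗ[k] 𝒱.part i :=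
  Submodule.projectionOnto (𝒱.part i) (𝒱.part (i + 1)) (𝒱.isCompl_part i)

/-- The component of parity `i` of a vector, as a vector. -/
def DGSpace.proj (𝒱 : DGSpace k V) (i : ZMod 2) : V →ₗ[k] V :=
  (𝒱.part i).subtype ∘ₗ 𝒱.projOnto i

/-- The parity involution `v ↦ (-1)^{|v|} v`. -/
def DGSpace.invol (𝒱 : DGSpace k V) : V →ₗ[k] V := 𝒱.proj 0 - 𝒱.proj 1

/-- The parity reversion `ΠV`: the same vectors and the same differential, with the two parities
exchanged. -/
def DGSpace.shift (𝒱 : DGSpace k V) : DGSpace k V where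
  part i := 𝒱.part (i + 1)
  isCompl := by
    have h : (1 + 1 : ZMod 2) = 0 := by decide
    simpa [h] using 𝒱.isCompl.symm
  d := 𝒱.d
  d_mem i v hv := 𝒱.d_mem (i + 1) v hv
  d_d := 𝒱.d_d

/-- The supertrace of an operator: its trace on the even part minus its trace on the odd part
(this is the trace of an endomorphism of a super vector space). -/
def DGSpace.supertrace (𝒱 : DGSpace k V) (φ : V →ₗ[k] V) : k :=
  LinearMap.trace k V (φ ∘ₗ 𝒱.invol)

theorem DGSpace.proj_self (𝒱 : DGSpace k V) {i : ZMod 2} {v : V} (hv : v ∈ 𝒱.part i) :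
    𝒱.proj i v = v := by
  simp only [DGSpace.proj, DGSpace.projOnto, LinearMap.comp_apply, Submodule.subtype_apply]
  exact congrArg Subtype.val
    (Submodule.projectionOnto_apply_left (𝒱.isCompl_part i) ⟨v, hv⟩)

theorem DGSpace.proj_other (𝒱 : DGSpace k V) {i : ZMod 2} {v : V} (hv : v ∈ 𝒱.part (i + 1)) :
    𝒱.proj i v = 0 := by
  simp only [DGSpace.proj, DGSpace.projOnto, LinearMap.comp_apply, Submodule.subtype_apply]
  rw [Submodule.projectionOnto_apply_of_mem_right (𝒱.isCompl_part i) hv]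
  rfl

theorem DGSpace.invol_of_mem (𝒱 : DGSpace k V) {i : ZMod 2} {v : V} (hv : v ∈ 𝒱.part i) :
    𝒱.invol v = sgn k i • v := by
  have h : (1 + 1 : ZMod 2) = 0 := by decide
  rcases zmod_two_cases i with rfl | rfl
  · have h1 : 𝒱.proj 1 v = 0 := 𝒱.proj_other (by rw [h]; exact hv)
    simp [DGSpace.invol, 𝒱.proj_self hv, h1, sgn]
  · have h1 : 𝒱.proj 0 v = 0 := 𝒱.proj_other (by simpa using hv)
    simp [DGSpace.invol, 𝒱.proj_self hv, h1, sgn]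

theorem DGSpace.proj_mem (𝒱 : DGSpace k V) (i : ZMod 2) (v : V) : 𝒱.proj i v ∈ 𝒱.part i :=
  (𝒱.projOnto i v).2

theorem DGSpace.exists_add (𝒱 : DGSpace k V) (v : V) :
    ∃ a ∈ 𝒱.part 0, ∃ b ∈ 𝒱.part 1, a + b = v := by
  have h : v ∈ 𝒱.part 0 ⊔ 𝒱.part 1 := by rw [𝒱.isCompl.sup_eq_top]; trivial
  exact Submodule.mem_sup.mp h

theorem DGSpace.invol_mem (𝒱 : DGSpace k V) {i : ZMod 2} {v : V} (hv : v ∈ 𝒱.part i) :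
    𝒱.invol v ∈ 𝒱.part i := by
  rw [𝒱.invol_of_mem hv]; exact Submodule.smul_mem _ _ hv

theorem sgn_add (i j : ZMod 2) : sgn k (i + j) = sgn k i * sgn k j := by
  have h : (1 + 1 : ZMod 2) = 0 := by decide
  rcases zmod_two_cases i with rfl | rfl <;> rcases zmod_two_cases j with rfl | rfl <;>
    simp [sgn, h]

theorem sgn_mul_self (i : ZMod 2) : sgn k i * sgn k i = 1 := by
  rcases zmod_two_cases i with rfl | rfl <;> simp [sgn]

end Space

/-! ### Commutative dg algebras and tensor products of dg super vector spaces -/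

/-- The structure of a (unital, supercommutative) dg algebra on a `k`-algebra `A`. -/
structure CDGA (k A : Type*) [Field k] [Ring A] [Algebra k A] extends DGSpace k A where
  one_mem : (1 : A) ∈ part 0
  mul_mem : ∀ i j, ∀ a ∈ part i, ∀ b ∈ part j, a * b ∈ part (i + j)
  mul_comm : ∀ i j, ∀ a ∈ part i, ∀ b ∈ part j, a * b = sgn k (i * j) • (b * a)
  leibniz : ∀ i, ∀ a ∈ part i, ∀ b, d (a * b) = d a * b + sgn k i • (a * d b)

/-- A cdga is unimodular if multiplication by every element has zero (super)trace. -/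
def CDGA.Unimodular {k A : Type*} [Field k] [Ring A] [Algebra k A] (𝒜 : CDGA k A) : Prop :=
  ∀ a : A, 𝒜.supertrace (LinearMap.mulLeft k a) = 0

section Tensor

variable {k U V : Type*} [Field k] [AddCommGroup U] [Module k U] [AddCommGroup V] [Module k V]

/-- The component `⨁_j U_j ⊗ V_{i-j}` of parity `i` of `U ⊗ V`. -/
def tensorPart (𝒰 : DGSpace k U) (𝒱 : DGSpace k V) (i : ZMod 2) : Submodule k (U ⊗[k] V) :=
  ⨆ j : ZMod 2, LinearMap.range (TensorProduct.mapIncl (𝒰.part j) (𝒱.part (i - j)))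

theorem tmul_mem_tensorPart (𝒰 : DGSpace k U) (𝒱 : DGSpace k V) {i j : ZMod 2} {u : U} {v : V}
    (hu : u ∈ 𝒰.part i) (hv : v ∈ 𝒱.part j) : u ⊗ₜ[k] v ∈ tensorPart 𝒰 𝒱 (i + j) := by
  refine Submodule.mem_iSup_of_mem i ?_
  have h : i + j - i = j := by ring
  rw [h]
  exact ⟨(⟨u, hu⟩ : 𝒰.part i) ⊗ₜ (⟨v, hv⟩ : 𝒱.part j), by simp [TensorProduct.mapIncl]⟩

theorem tensorPart_induction (𝒰 : DGSpace k U) (𝒱 : DGSpace k V) {i : ZMod 2}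
    {S : Submodule k (U ⊗[k] V)}
    (h : ∀ a b, a + b = i → ∀ u ∈ 𝒰.part a, ∀ v ∈ 𝒱.part b, u ⊗ₜ[k] v ∈ S) :
    tensorPart 𝒰 𝒱 i ≤ S := by
  refine iSup_le fun j => ?_
  rintro _ ⟨x, rfl⟩
  induction x using TensorProduct.induction_on with
  | zero => simp
  | tmul u v =>
    exact h j (i - j) (by ring) u u.2 v v.2
  | add x y hx hy => rw [map_add]; exact S.add_mem hx hy

theorem tensor_invol (𝒰 : DGSpace k U) (𝒱 : DGSpace k V) (i : ZMod 2) {x : U ⊗[k] V}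
    (hx : x ∈ tensorPart 𝒰 𝒱 i) :
    TensorProduct.map 𝒰.invol 𝒱.invol x = sgn k i • x := by
  have key : tensorPart 𝒰 𝒱 i ≤
      LinearMap.eqLocus (TensorProduct.map 𝒰.invol 𝒱.invol) (sgn k i • LinearMap.id) := by
    refine tensorPart_induction 𝒰 𝒱 ?_
    rintro a b rfl u hu v hv
    simp only [LinearMap.mem_eqLocus, TensorProduct.map_tmul, 𝒰.invol_of_mem hu,
      𝒱.invol_of_mem hv, LinearMap.smul_apply, LinearMap.id_apply, sgn_add,
      TensorProduct.smul_tmul_smul]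
  exact key hx

theorem tensorPart_isCompl [CharZero k] (𝒰 : DGSpace k U) (𝒱 : DGSpace k V) :
    IsCompl (tensorPart 𝒰 𝒱 0) (tensorPart 𝒰 𝒱 1) := by
  constructor
  · rw [Submodule.disjoint_def]
    intro x h0 h1
    have e0 := tensor_invol 𝒰 𝒱 0 h0
    have e1 := tensor_invol 𝒰 𝒱 1 h1
    rw [e0] at e1
    simp only [sgn, if_true, one_smul, one_ne_zero, if_false, neg_smul] at e1
    have h2 : (2 : k) • x = 0 := by
      rw [two_smul]; nth_rewrite 1 [e1]; simp
    exact (smul_eq_zero.mp h2).resolve_left two_ne_zero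
  · rw [codisjoint_iff_le_sup]
    intro x _
    have h11 : (1 + 1 : ZMod 2) = 0 := by decide
    induction x using TensorProduct.induction_on with
    | zero => exact Submodule.zero_mem _
    | add x y hx hy => exact Submodule.add_mem _ (hx trivial) (hy trivial)
    | tmul u v =>
      obtain ⟨a, ha, b, hb, rfl⟩ := 𝒰.exists_add u
      obtain ⟨c, hc, e, he, rfl⟩ := 𝒱.exists_add v
      rw [TensorProduct.add_tmul, TensorProduct.tmul_add, TensorProduct.tmul_add]
      have q1 := Submodule.mem_sup_left (T := tensorPart 𝒰 𝒱 1)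
        (tmul_mem_tensorPart 𝒰 𝒱 ha hc)
      have q2 := Submodule.mem_sup_right (S := tensorPart 𝒰 𝒱 0)
        (tmul_mem_tensorPart 𝒰 𝒱 ha he)
      have q3 := Submodule.mem_sup_right (S := tensorPart 𝒰 𝒱 0)
        (tmul_mem_tensorPart 𝒰 𝒱 hb hc)
      have q4 : b ⊗ₜ[k] e ∈ tensorPart 𝒰 𝒱 0 := by
        simpa [h11] using tmul_mem_tensorPart 𝒰 𝒱 hb he
      simp only [add_zero, zero_add] at q1 q2 q3
      exact Submodule.add_mem _ (Submodule.add_mem _ q1 q2)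
        (Submodule.add_mem _ q3 (Submodule.mem_sup_left q4))

/-- The differential `u ⊗ v ↦ du ⊗ v + (-1)^{|u|} u ⊗ dv`. -/
def tensorD (𝒰 : DGSpace k U) (𝒱 : DGSpace k V) : U ⊗[k] V →ₗ[k] U ⊗[k] V :=
  TensorProduct.map 𝒰.d LinearMap.id + TensorProduct.map 𝒰.invol 𝒱.d

theorem tensorD_tmul (𝒰 : DGSpace k U) (𝒱 : DGSpace k V) {i : ZMod 2} {u : U}
    (hu : u ∈ 𝒰.part i) (v : V) :
    tensorD 𝒰 𝒱 (u ⊗ₜ v) = 𝒰.d u ⊗ₜ v + sgn k i • (u ⊗ₜ[k] 𝒱.d v) := by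
  simp [tensorD, 𝒰.invol_of_mem hu, TensorProduct.smul_tmul']

/-- The tensor product of two dg super vector spaces. -/
def DGSpace.tensor [CharZero k] (𝒰 : DGSpace k U) (𝒱 : DGSpace k V) :
    DGSpace k (U ⊗[k] V) where
  part := tensorPart 𝒰 𝒱
  isCompl := tensorPart_isCompl 𝒰 𝒱
  d := tensorD 𝒰 𝒱
  d_mem i x hx := by
    have key : tensorPart 𝒰 𝒱 i ≤ (tensorPart 𝒰 𝒱 (i + 1)).comap (tensorD 𝒰 𝒱) := by
      refine tensorPart_induction 𝒰 𝒱 ?_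
      rintro a b rfl u hu v hv
      rw [Submodule.mem_comap, tensorD_tmul 𝒰 𝒱 hu]
      have h1 := tmul_mem_tensorPart 𝒰 𝒱 (𝒰.d_mem a u hu) hv
      have h2 := tmul_mem_tensorPart 𝒰 𝒱 hu (𝒱.d_mem b v hv)
      rw [show a + 1 + b = a + b + 1 by ring] at h1
      rw [← add_assoc] at h2
      exact Submodule.add_mem _ h1 (Submodule.smul_mem _ _ h2)
    exact key hx
  d_d x := by
    induction x using TensorProduct.induction_on with
    | zero => simp
    | add x y hx hy => rw [map_add, map_add, hx, hy, add_zero]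
    | tmul u v =>
      have key : ∀ i, ∀ a ∈ 𝒰.part i, tensorD 𝒰 𝒱 (tensorD 𝒰 𝒱 (a ⊗ₜ v)) = 0 := by
        intro i a ha
        rw [tensorD_tmul 𝒰 𝒱 ha, map_add, map_smul, tensorD_tmul 𝒰 𝒱 (𝒰.d_mem i a ha),
          tensorD_tmul 𝒰 𝒱 ha, 𝒰.d_d, 𝒱.d_d, sgn_add]
        simp [sgn]
      obtain ⟨a, ha, b, hb, rfl⟩ := 𝒰.exists_add u
      rw [TensorProduct.add_tmul, map_add, map_add, key 0 a ha, key 1 b hb, add_zero]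

end Tensor

/-! ### The complete symmetric algebra of the dual space -/

section Forms

variable {k W : Type*} [Field k] [AddCommGroup W] [Module k W]

/-- The complete symmetric algebra `Ŝ W^*` (formal functions on a finite-dimensional super space
`W`), as `∏_n ((W^{⊗ n})_{S_n})^*`: a formal function is the family of its Taylor coefficients at
the origin, which are multilinear forms on `W` that are symmetric in the super sense. The form of
arity `n` is the restriction of `f` to lists of length `n`. -/
def Form (𝒲 : DGSpace k W) : Submodule k (List W → k) where
  carrier := {f |
    (∀ l₁ l₂ u v, f (l₁ ++ (u + v) :: l₂) = f (l₁ ++ u :: l₂) + f (l₁ ++ v :: l₂)) ∧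
    (∀ l₁ l₂ (c : k) u, f (l₁ ++ (c • u) :: l₂) = c * f (l₁ ++ u :: l₂)) ∧
    (∀ l₁ l₂ i j, ∀ u ∈ 𝒲.part i, ∀ v ∈ 𝒲.part j,
      f (l₁ ++ u :: v :: l₂) = sgn k (i * j) * f (l₁ ++ v :: u :: l₂))}
  zero_mem' := by simp
  add_mem' := by
    rintro f g ⟨f1, f2, f3⟩ ⟨g1, g2, g3⟩
    refine ⟨fun l₁ l₂ u v => ?_, fun l₁ l₂ c u => ?_, fun l₁ l₂ i j u hu v hv => ?_⟩
    · simp only [Pi.add_apply, f1, g1]; ring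
    · simp only [Pi.add_apply, f2, g2]; ring
    · simp only [Pi.add_apply, f3 l₁ l₂ i j u hu v hv, g3 l₁ l₂ i j u hu v hv]; ring
  smul_mem' := by
    rintro c f ⟨f1, f2, f3⟩
    refine ⟨fun l₁ l₂ u v => ?_, fun l₁ l₂ c u => ?_, fun l₁ l₂ i j u hu v hv => ?_⟩
    · simp only [Pi.smul_apply, f1, smul_eq_mul]; ring
    · simp only [Pi.smul_apply, f2, smul_eq_mul]; ring
    · simp only [Pi.smul_apply, f3 l₁ l₂ i j u hu v hv, smul_eq_mul]; ring

/-- `f` is homogeneous of parity `q`: it vanishes on homogeneous arguments of any other total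
parity. -/
def HasParity {𝒲 : DGSpace k W} (q : ZMod 2) (f : Form 𝒲) : Prop :=
  ∀ (l : List W) (s : List (ZMod 2)), List.Forall₂ (fun w i => w ∈ 𝒲.part i) l s →
    s.sum ≠ q → f.1 l = 0

/-- `f ∈ Ŝ_{≥ n} W^*`. -/
def AtLeast {𝒲 : DGSpace k W} (n : ℕ) (f : Form 𝒲) : Prop :=
  ∀ l : List W, l.length < n → f.1 l = 0

/-- Contraction with `w` in the first slot, on families of multilinear forms. -/
def cut (w : W) (f : List W → k) : List W → k := fun l => f (w :: l)

/-- The operator `f ↦ (-1)^{|w| |f|} f`, for `w` of parity `i`. -/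
def twist (𝒲 : DGSpace k W) (i : ZMod 2) (f : List W → k) : List W → k :=
  if i = 0 then f else fun l => f (l.map 𝒲.invol)

theorem cut_mem {𝒲 : DGSpace k W} (w : W) {f : List W → k} (hf : f ∈ Form 𝒲) :
    cut w f ∈ Form 𝒲 := by
  obtain ⟨f1, f2, f3⟩ := hf
  exact ⟨fun l₁ l₂ u v => f1 (w :: l₁) l₂ u v, fun l₁ l₂ c u => f2 (w :: l₁) l₂ c u,
    fun l₁ l₂ i j u hu v hv => f3 (w :: l₁) l₂ i j u hu v hv⟩

theorem twist_mem {𝒲 : DGSpace k W} (i : ZMod 2) {f : List W → k} (hf : f ∈ Form 𝒲) :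
    twist 𝒲 i f ∈ Form 𝒲 := by
  unfold twist
  split_ifs
  · exact hf
  · obtain ⟨f1, f2, f3⟩ := hf
    refine ⟨fun l₁ l₂ u v => ?_, fun l₁ l₂ c u => ?_, fun l₁ l₂ i j u hu v hv => ?_⟩
    · simp only [List.map_append, List.map_cons, map_add, f1]
    · simp only [List.map_append, List.map_cons, map_smul, f2]
    · simp only [List.map_append, List.map_cons]
      exact f3 _ _ i j _ (𝒲.invol_mem hu) _ (𝒲.invol_mem hv)

theorem cut_add {𝒲 : DGSpace k W} {f : List W → k} (hf : f ∈ Form 𝒲) (u v : W) :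
    cut (u + v) f = cut u f + cut v f := by
  funext l; exact hf.1 [] l u v

theorem cut_smul {𝒲 : DGSpace k W} {f : List W → k} (hf : f ∈ Form 𝒲) (c : k) (u : W) :
    cut (c • u) f = c • cut u f := by
  funext l; exact hf.2.1 [] l c u

theorem cut_zero {𝒲 : DGSpace k W} {f : List W → k} (hf : f ∈ Form 𝒲) :
    cut (0 : W) f = 0 := by
  have h := cut_smul hf (0 : k) (0 : W)
  simpa using h

theorem cut_cut {𝒲 : DGSpace k W} {f : List W → k} (hf : f ∈ Form 𝒲) {i j : ZMod 2} {u v : W}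
    (hu : u ∈ 𝒲.part i) (hv : v ∈ 𝒲.part j) :
    cut v (cut u f) = sgn k (i * j) • cut u (cut v f) := by
  funext l; exact hf.2.2 [] l i j u hu v hv

/-- The left partial derivative `∂_w` along a vector `w`: for homogeneous coordinates
`x_1, …, x_n ∈ W^*` and the dual basis `e_1, …, e_n` of `W`, the operator `∂_{x_i}` is
`∂_{e_i}`. -/
def deriv (𝒲 : DGSpace k W) (w : W) : Form 𝒲 →ₗ[k] Form 𝒲 where
  toFun f := ⟨cut w f.1, cut_mem w f.2⟩
  map_add' _ _ := rfl
  map_smul' _ _ := rfl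

/-- The product of two families of multilinear forms, evaluated on a list. It is the (shuffle)
product for which the value at the origin is multiplicative and every `∂_w` is a derivation:
`∂_w (f g) = (∂_w f) g + (-1)^{|w| |f|} f (∂_w g)`. -/
def mulAux (𝒲 : DGSpace k W) : List W → (List W → k) → (List W → k) → k
  | [], f, g => f [] * g []
  | w :: l, f, g => mulAux 𝒲 l (cut w f) g +
      (mulAux 𝒲 l (twist 𝒲 0 f) (cut (𝒲.proj 0 w) g) +
        mulAux 𝒲 l (twist 𝒲 1 f) (cut (𝒲.proj 1 w) g))

theorem cut_add_fun (w : W) (f g : List W → k) : cut w (f + g) = cut w f + cut w g := rfl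

theorem cut_smul_fun (w : W) (c : k) (f : List W → k) : cut w (c • f) = c • cut w f := rfl

theorem twist_add (𝒲 : DGSpace k W) (i : ZMod 2) (f g : List W → k) :
    twist 𝒲 i (f + g) = twist 𝒲 i f + twist 𝒲 i g := by
  unfold twist; split_ifs <;> rfl

theorem twist_smul (𝒲 : DGSpace k W) (i : ZMod 2) (c : k) (f : List W → k) :
    twist 𝒲 i (c • f) = c • twist 𝒲 i f := by
  unfold twist; split_ifs <;> rfl

theorem mulAux_add_left (𝒲 : DGSpace k W) (l : List W) (f f' g : List W → k) :
    mulAux 𝒲 l (f + f') g = mulAux 𝒲 l f g + mulAux 𝒲 l f' g := by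
  induction l generalizing f f' g with
  | nil => simp [mulAux, add_mul]
  | cons w l ih => simp only [mulAux, cut_add_fun, twist_add, ih]; ring

theorem mulAux_add_right (𝒲 : DGSpace k W) (l : List W) (f g g' : List W → k) :
    mulAux 𝒲 l f (g + g') = mulAux 𝒲 l f g + mulAux 𝒲 l f g' := by
  induction l generalizing f g g' with
  | nil => simp [mulAux, mul_add]
  | cons w l ih => simp only [mulAux, cut_add_fun, ih]; ring

theorem mulAux_smul_left (𝒲 : DGSpace k W) (l : List W) (c : k) (f g : List W → k) :
    mulAux 𝒲 l (c • f) g = c * mulAux 𝒲 l f g := by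
  induction l generalizing f g with
  | nil => simp [mulAux, mul_assoc]
  | cons w l ih => simp only [mulAux, cut_smul_fun, twist_smul, ih]; ring

theorem mulAux_smul_right (𝒲 : DGSpace k W) (l : List W) (c : k) (f g : List W → k) :
    mulAux 𝒲 l f (c • g) = c * mulAux 𝒲 l f g := by
  induction l generalizing f g with
  | nil => simp only [mulAux, Pi.smul_apply, smul_eq_mul]; ring
  | cons w l ih => simp only [mulAux, cut_smul_fun, ih]; ring

theorem mulAux_zero_right (𝒲 : DGSpace k W) (l : List W) (f : List W → k) :
    mulAux 𝒲 l f 0 = 0 := by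
  simpa using mulAux_smul_right 𝒲 l (0 : k) f 0

theorem mulAux_cons_homog (𝒲 : DGSpace k W) {i : ZMod 2} {w : W} (hw : w ∈ 𝒲.part i)
    (l : List W) (f : List W → k) {g : List W → k} (hg : g ∈ Form 𝒲) :
    mulAux 𝒲 (w :: l) f g = mulAux 𝒲 l (cut w f) g + mulAux 𝒲 l (twist 𝒲 i f) (cut w g) := by
  have h11 : (1 + 1 : ZMod 2) = 0 := by decide
  rcases zmod_two_cases i with rfl | rfl
  · have h1 : 𝒲.proj 1 w = 0 := 𝒲.proj_other (by rw [h11]; exact hw)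
    simp [mulAux, 𝒲.proj_self hw, h1, cut_zero hg, mulAux_zero_right]
  · have h1 : 𝒲.proj 0 w = 0 := 𝒲.proj_other (by simpa using hw)
    simp [mulAux, 𝒲.proj_self hw, h1, cut_zero hg, mulAux_zero_right]

theorem cut_twist (𝒲 : DGSpace k W) {i j : ZMod 2} {w : W} (hw : w ∈ 𝒲.part j)
    {f : List W → k} (hf : f ∈ Form 𝒲) :
    cut w (twist 𝒲 i f) = sgn k (i * j) • twist 𝒲 i (cut w f) := by
  rcases zmod_two_cases i with rfl | rfl
  · simp [twist, sgn]
  · funext l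
    have h := congrFun (cut_smul hf (sgn k j) w) (l.map 𝒲.invol)
    simp only [twist, one_ne_zero, if_false, cut, List.map_cons, 𝒲.invol_of_mem hw, one_mul,
      Pi.smul_apply] at h ⊢
    exact h

theorem twist_twist (𝒲 : DGSpace k W) (i j : ZMod 2) (f : List W → k) :
    twist 𝒲 i (twist 𝒲 j f) = twist 𝒲 j (twist 𝒲 i f) := by
  unfold twist; split_ifs <;> rfl

theorem mulAux_mem (𝒲 : DGSpace k W) {f g : List W → k} (hf : f ∈ Form 𝒲) (hg : g ∈ Form 𝒲) :
    (fun l => mulAux 𝒲 l f g) ∈ Form 𝒲 := by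
  refine ⟨fun l₁ => ?_, fun l₁ => ?_, fun l₁ => ?_⟩
  · induction l₁ generalizing f g with
    | nil =>
      intro l₂ u v
      simp only [List.nil_append, mulAux, cut_add hf, map_add, cut_add hg, mulAux_add_left,
        mulAux_add_right]
      ring
    | cons w l ih =>
      intro l₂ u v
      beta_reduce at ih
      simp only [List.cons_append, mulAux]
      rw [ih (cut_mem _ hf) hg, ih (twist_mem 0 hf) (cut_mem _ hg),
        ih (twist_mem 1 hf) (cut_mem _ hg)]
      ring
  · induction l₁ generalizing f g with
    | nil =>
      intro l₂ c u
      simp only [List.nil_append, mulAux, cut_smul hf, map_smul, cut_smul hg, mulAux_smul_left,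
        mulAux_smul_right]
      ring
    | cons w l ih =>
      intro l₂ c u
      beta_reduce at ih
      simp only [List.cons_append, mulAux]
      rw [ih (cut_mem _ hf) hg, ih (twist_mem 0 hf) (cut_mem _ hg),
        ih (twist_mem 1 hf) (cut_mem _ hg)]
      ring
  · induction l₁ generalizing f g with
    | nil =>
      intro l₂ i j u hu v hv
      simp only [List.nil_append]
      rw [mulAux_cons_homog 𝒲 hu _ _ hg, mulAux_cons_homog 𝒲 hv _ _ hg,
        mulAux_cons_homog 𝒲 hv _ _ (cut_mem _ hg), mulAux_cons_homog 𝒲 hv _ _ hg,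
        mulAux_cons_homog 𝒲 hu _ _ hg, mulAux_cons_homog 𝒲 hu _ _ (cut_mem _ hg),
        cut_cut hf hu hv, cut_cut hg hu hv, cut_twist 𝒲 hv hf, cut_twist 𝒲 hu hf,
        twist_twist 𝒲 i j, mul_comm j i]
      simp only [mulAux_smul_left, mulAux_smul_right]
      have h := sgn_mul_self (k := k) (i * j)
      linear_combination (-(mulAux 𝒲 l₂ (twist 𝒲 j (cut u f)) (cut v g))) * h
    | cons w l ih =>
      intro l₂ i j u hu v hv
      beta_reduce at ih
      simp only [List.cons_append, mulAux]
      rw [ih (cut_mem _ hf) hg l₂ i j u hu v hv, ih (twist_mem 0 hf) (cut_mem _ hg) l₂ i j u hu v hv,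
        ih (twist_mem 1 hf) (cut_mem _ hg) l₂ i j u hu v hv]
      ring

/-- The product of the algebra `Ŝ W^*`. -/
def mul {𝒲 : DGSpace k W} (f g : Form 𝒲) : Form 𝒲 :=
  ⟨fun l => mulAux 𝒲 l f.1 g.1, mulAux_mem 𝒲 f.2 g.2⟩

/-- The inclusion `W^* ⊆ Ŝ W^*` of the linear functions. -/
def lin (𝒲 : DGSpace k W) : Module.Dual k W →ₗ[k] Form 𝒲 where
  toFun x := ⟨fun l => match l with
    | [w] => x w
    | _ => 0, by
    refine ⟨fun l₁ l₂ u v => ?_, fun l₁ l₂ c u => ?_, fun l₁ l₂ i j u hu v hv => ?_⟩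
    · rcases l₁ with _ | ⟨a, _ | ⟨b, l₁⟩⟩ <;> rcases l₂ with _ | ⟨e, l₂⟩ <;> simp
    · rcases l₁ with _ | ⟨a, _ | ⟨b, l₁⟩⟩ <;> rcases l₂ with _ | ⟨e, l₂⟩ <;> simp
    · rcases l₁ with _ | ⟨a, _ | ⟨b, l₁⟩⟩ <;> simp⟩
  map_add' x y := by
    ext l; rcases l with _ | ⟨a, _ | ⟨b, l⟩⟩ <;> simp
  map_smul' c x := by
    ext l; rcases l with _ | ⟨a, _ | ⟨b, l⟩⟩ <;> simp

/-! ### Formal vector fields -/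

/-- The derivation of `Ŝ W^*` induced by the differential `d` of `W`, evaluated on a list:
`(w_1, …, w_n) ↦ ∑_i (-1)^{|w_1| + ⋯ + |w_{i-1}|} f (w_1, …, d w_i, …, w_n)`. -/
def diffAux (𝒲 : DGSpace k W) : List W → (List W → k) → k
  | [], _ => 0
  | w :: l, f => f (𝒲.d w :: l) + diffAux 𝒲 l (cut (𝒲.invol w) f)

theorem diffAux_add (𝒲 : DGSpace k W) (l : List W) (f g : List W → k) :
    diffAux 𝒲 l (f + g) = diffAux 𝒲 l f + diffAux 𝒲 l g := by
  induction l generalizing f g with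
  | nil => simp [diffAux]
  | cons w l ih => simp only [diffAux, cut_add_fun, ih, Pi.add_apply]; ring

theorem diffAux_smul (𝒲 : DGSpace k W) (l : List W) (c : k) (f : List W → k) :
    diffAux 𝒲 l (c • f) = c * diffAux 𝒲 l f := by
  induction l generalizing f with
  | nil => simp [diffAux]
  | cons w l ih => simp only [diffAux, cut_smul_fun, ih, Pi.smul_apply, smul_eq_mul]; ring

theorem diffAux_mem (𝒲 : DGSpace k W) {f : List W → k} (hf : f ∈ Form 𝒲) :
    (fun l => diffAux 𝒲 l f) ∈ Form 𝒲 := by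
  refine ⟨fun l₁ => ?_, fun l₁ => ?_, fun l₁ => ?_⟩
  · induction l₁ generalizing f with
    | nil =>
      intro l₂ u v
      have h := hf.1 [] l₂ (𝒲.d u) (𝒲.d v)
      simp only [List.nil_append] at h
      simp only [List.nil_append, diffAux, map_add, cut_add hf, diffAux_add, h]
      ring
    | cons w l ih =>
      intro l₂ u v
      have h := hf.1 (𝒲.d w :: l) l₂ u v
      simp only [List.cons_append] at h
      beta_reduce at ih
      simp only [List.cons_append, diffAux]
      rw [ih (cut_mem _ hf), h]
      ring
  · induction l₁ generalizing f with
    | nil =>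
      intro l₂ c u
      have h := hf.2.1 [] l₂ c (𝒲.d u)
      simp only [List.nil_append] at h
      simp only [List.nil_append, diffAux, map_smul, cut_smul hf, diffAux_smul, h]
      ring
    | cons w l ih =>
      intro l₂ c u
      have h := hf.2.1 (𝒲.d w :: l) l₂ c u
      simp only [List.cons_append] at h
      beta_reduce at ih
      simp only [List.cons_append, diffAux]
      rw [ih (cut_mem _ hf), h]
      ring
  · induction l₁ generalizing f with
    | nil =>
      intro l₂ i j u hu v hv
      have a1 := congrFun (cut_cut hf (𝒲.d_mem i u hu) hv) l₂
      have a2 := congrFun (cut_cut hf hu (𝒲.d_mem j v hv)) l₂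
      have a3 := cut_cut hf hu hv
      simp only [List.nil_append, diffAux, 𝒲.invol_of_mem hu, 𝒲.invol_of_mem hv, cut_smul hf,
        cut_smul (cut_mem _ hf), cut_smul_fun, diffAux_smul, a3, Pi.smul_apply, smul_eq_mul]
      simp only [cut, Pi.smul_apply, smul_eq_mul] at a1 a2 ⊢
      rw [a1, a2, add_mul, mul_add, sgn_add, sgn_add, one_mul, mul_one]
      have h := sgn_mul_self (k := k) i
      have h' := sgn_mul_self (k := k) j
      linear_combination (sgn k (i * j) * f (𝒲.d v :: u :: l₂)) * h
    | cons w l ih =>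
      intro l₂ i j u hu v hv
      have h := hf.2.2 (𝒲.d w :: l) l₂ i j u hu v hv
      simp only [List.cons_append] at h
      beta_reduce at ih
      simp only [List.cons_append, diffAux]
      rw [ih (cut_mem _ hf) l₂ i j u hu v hv, h]
      ring

/-- The linear vector field on `W` given by its differential, as an operator on `Ŝ W^*`. -/
def diff (𝒲 : DGSpace k W) : Form 𝒲 →ₗ[k] Form 𝒲 where
  toFun f := ⟨fun l => diffAux 𝒲 l f.1, diffAux_mem 𝒲 f.2⟩
  map_add' f g := by ext l; exact diffAux_add 𝒲 l f.1 g.1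
  map_smul' c f := by ext l; exact diffAux_smul 𝒲 l c f.1

/-- `D` is a formal vector field of parity `p`, that is, a derivation of parity `p` of the graded
algebra `Ŝ W^*`. (For finite-dimensional `W`, derivations are automatically continuous.) -/
structure IsDerivation {𝒲 : DGSpace k W} (p : ZMod 2) (D : Form 𝒲 →ₗ[k] Form 𝒲) : Prop where
  parity : ∀ q f, HasParity q f → HasParity (q + p) (D f)
  leibniz : ∀ q f g, HasParity q f → D (mul f g) = mul (D f) g + sgn k (p * q) • mul f (D g)

/-- The commutator `D E - (-1)^{p q} E D` of operators of parities `p` and `q`. -/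
def bracket {𝒲 : DGSpace k W} (p q : ZMod 2) (D E : Form 𝒲 →ₗ[k] Form 𝒲) :
    Form 𝒲 →ₗ[k] Form 𝒲 :=
  D ∘ₗ E + (-sgn k (p * q)) • (E ∘ₗ D)

/-- The divergence `∇ D = ∑_i (-1)^{|f_i| |x_i|} ∂_{x_i} f_i` of a vector field `D` of parity `p`,
where `f_i = D x_i` has parity `p + |x_i|` and the `x_i` are the coordinates for a basis of `W`
consisting of a basis of its even part and a basis of its odd part. -/
def divergence [FiniteDimensional k W] {𝒲 : DGSpace k W} (p : ZMod 2)
    (D : Form 𝒲 →ₗ[k] Form 𝒲) : Form 𝒲 :=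
  ∑ i : ZMod 2, ∑ j, sgn k ((p + i) * i) •
    deriv 𝒲 (Module.finBasis k (𝒲.part i) j : W)
      (D (lin 𝒲 ((Module.finBasis k (𝒲.part i)).coord j ∘ₗ 𝒲.projOnto i)))

/-- The symmetric multilinear maps `W^{⊗ n} → W` corresponding to a vector field `D`: the vector
`taylor D [w_1, …, w_n]` is determined by `x (taylor D [w_1, …, w_n]) = (D x) (w_1, …, w_n)` for
all `x ∈ W^*`. -/
def taylor [FiniteDimensional k W] {𝒲 : DGSpace k W} (D : Form 𝒲 →ₗ[k] Form 𝒲)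
    (l : List W) : W :=
  (Module.evalEquiv k W).symm
    (LinearMap.proj l ∘ₗ (Form 𝒲).subtype ∘ₗ D ∘ₗ lin 𝒲)

end Forms

/-! ### `L_∞` algebras and unimodularity -/

section LInfty

variable {k V : Type*} [Field k] [AddCommGroup V] [Module k V]

/-- An `L_∞` structure on the dg super vector space `V`: an odd element `m` of
`Der_{≥ 2} (Ŝ ΠV^*)`, that is, an odd derivation sending `ΠV^*` to `Ŝ_{≥ 2} ΠV^*`, that satisfies
the Maurer-Cartan equation `[d, m] + (1/2) [m, m] = 0`. -/
@[ext]
structure LInfty (𝒱 : DGSpace k V) where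
  m : Form 𝒱.shift →ₗ[k] Form 𝒱.shift
  isDerivation : IsDerivation 1 m
  atLeast : ∀ x : Module.Dual k V, AtLeast 2 (m (lin 𝒱.shift x))
  maurerCartan : bracket 1 1 (diff 𝒱.shift) m + (1 / 2 : k) • bracket 1 1 m m = 0

variable [FiniteDimensional k V] {𝒱 : DGSpace k V}

/-- The pair `(m, f)` is a unimodular `L_∞` structure, for an `L_∞` structure `m` and a formal
function `f`: `f` is even and `d f + (1/2) ∇ m + m f = 0`. -/
def LInfty.IsUnimodularWith (L : LInfty 𝒱) (f : Form 𝒱.shift) : Prop :=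
  HasParity 0 f ∧ diff 𝒱.shift f + (1 / 2 : k) • divergence 1 L.m + L.m f = 0

/-- `m` is strictly unimodular: `(m, 0)` is a unimodular `L_∞` structure. -/
def LInfty.StrictlyUnimodular (L : LInfty 𝒱) : Prop := L.IsUnimodularWith 0

/-- `m` lifts to a unimodular `L_∞` structure `(m, f)`. -/
def LInfty.AdmitsUnimodularLift (L : LInfty 𝒱) : Prop := ∃ f, L.IsUnimodularWith f

end LInfty

/-! ### Tensor products of a cdga and an `L_∞` algebra -/

/-- The exponent of the Koszul sign that arises when, in the expression
`ξ a_1 v_1 a_2 v_2 ⋯ a_n v_n`, all of the `a_i` are moved to the left of `ξ` and of all the `v_j`.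
The list consists of the pairs of parities `(|a_i|, |v_i|)`, and `s` is the parity of `ξ`. -/
def koszul : ZMod 2 → List (ZMod 2 × ZMod 2) → ZMod 2
  | _, [] => 0
  | s, (α, β) :: l => s * α + koszul (s + β) l

/-- `M` is the tensor product `L_∞` structure on `A ⊗ V`: its multilinear maps are
`X^n ⊗ m_n`, where `X^n` is the `n`-fold product of `A` and `m_n` are the multilinear maps
`(ΠV)^{⊗ n} → ΠV` of the `L_∞` algebra `V`, with the sign given by the Koszul rule. -/
def IsTensorProduct {k A V : Type*} [Field k] [CharZero k] [Ring A] [Algebra k A]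
    [FiniteDimensional k A] [AddCommGroup V] [Module k V] [FiniteDimensional k V]
    (𝒜 : CDGA k A) {𝒱 : DGSpace k V} (L : LInfty 𝒱) (M : LInfty (𝒜.toDGSpace.tensor 𝒱)) : Prop :=
  ∀ (l : List (A × V)) (s : List (ZMod 2 × ZMod 2)),
    List.Forall₂ (fun x p => x.1 ∈ 𝒜.part p.1 ∧ x.2 ∈ 𝒱.shift.part p.2) l s →
    taylor M.m (l.map fun x => x.1 ⊗ₜ[k] x.2) =
      sgn k (koszul 1 s) • ((l.map Prod.fst).prod ⊗ₜ[k] taylor L.m (l.map Prod.snd))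

end SuperLInfty

end

/-!
Write `φ ⊠ g` for the formal function on `A ⊗ V` whose multilinear maps are
`(a₁ ⊗ v₁, …, aₙ ⊗ vₙ) ↦ ± φ(a₁ ⋯ aₙ) g(v₁, …, vₙ)`, where `φ ∈ A*` and `g` is a formal function
on `V`. The vector field `m` of `V` extends to `A ⊗ V` by `φ ⊠ g ↦ ± φ ⊠ m(g)`. Its multilinear
maps are the `± a₁ ⋯ aₙ ⊗ m̃ₙ(v₁, …, vₙ)`, and it inherits the Maurer–Cartan equation; summing its
derivatives along a basis of `A ⊗ V` over the basis of `A` shows that its divergence is `Tr ⊠ ∇(m)`,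
with `Tr` the functional `a ↦ Tr(x ↦ a x)`. As `∇(m)` has no constant term, `Tr ⊠ ∇(m) = 0` exactly
if `Tr = 0` or `∇(m) = 0`.

The functional `Tr` is even and vanishes on exact elements, so `Tr ⊠ f` is a unimodular lift for
`A ⊗ V` if `f` is one for `V`. Conversely, if `Tr ≠ 0`, then some even idempotent `e` of `A` has
`Tr(e) ≠ 0`: on the primary components of an even `a`, its traces are proportional to dimensions.
An even idempotent is closed, so restriction along `v ↦ e ⊗ v` is compatible with the differentials
and the vector fields and takes `Tr ⊠ ∇(m)` to `Tr(e) ∇(m)`; divided by `Tr(e)`, it turns a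
unimodular lift for `A ⊗ V` into one for `V`.
-/

noncomputable section

namespace SuperLInfty

/-! ### Parity -/

section Space

variable {k V : Type*} [Field k] [AddCommGroup V] [Module k V]

@[simp] theorem sgn_zero : sgn k 0 = 1 := by simp [sgn]

@[simp] theorem sgn_one : sgn k 1 = -1 := by simp [sgn]

theorem sgn_mul_cancel (i : ZMod 2) (c : k) : sgn k i * (sgn k i * c) = c := by
  rw [← mul_assoc, sgn_mul_self, one_mul]

theorem sgn_injective [CharZero k] : Function.Injective (sgn k) := by
  have h : (1 : k) ≠ -1 := self_ne_neg.mpr one_ne_zero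
  intro i j hij
  rcases zmod_two_cases i with rfl | rfl <;> rcases zmod_two_cases j with rfl | rfl <;>
    simp_all [eq_comm]

/-- The `i`-th power of the parity involution. -/
def DGSpace.involPow (𝒱 : DGSpace k V) (i : ZMod 2) : V →ₗ[k] V :=
  if i = 0 then LinearMap.id else 𝒱.invol

@[simp] theorem DGSpace.involPow_zero (𝒱 : DGSpace k V) : 𝒱.involPow 0 = LinearMap.id := by
  simp [involPow]

theorem DGSpace.involPow_one (𝒱 : DGSpace k V) : 𝒱.involPow 1 = 𝒱.invol := by
  simp [involPow]

theorem DGSpace.involPow_of_mem (𝒱 : DGSpace k V) (i : ZMod 2) {j : ZMod 2} {v : V}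
    (hv : v ∈ 𝒱.part j) : 𝒱.involPow i v = sgn k (i * j) • v := by
  rcases zmod_two_cases i with rfl | rfl
  · simp
  · simp [involPow_one, 𝒱.invol_of_mem hv]

theorem DGSpace.span_homogeneous (𝒱 : DGSpace k V) :
    Submodule.span k {v | ∃ i, v ∈ 𝒱.part i} = ⊤ := by
  refine Submodule.eq_top_iff'.mpr fun v => ?_
  obtain ⟨a, ha, b, hb, rfl⟩ := 𝒱.exists_add v
  exact add_mem (Submodule.subset_span ⟨0, ha⟩) (Submodule.subset_span ⟨1, hb⟩)

theorem DGSpace.hom_ext (𝒱 : DGSpace k V) {U : Type*} [AddCommGroup U] [Module k U]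
    {f g : V →ₗ[k] U} (h : ∀ i, ∀ v ∈ 𝒱.part i, f v = g v) : f = g :=
  LinearMap.ext_on 𝒱.span_homogeneous fun v ⟨i, hv⟩ => h i v hv

theorem DGSpace.involPow_involPow (𝒱 : DGSpace k V) (i j : ZMod 2) (v : V) :
    𝒱.involPow i (𝒱.involPow j v) = 𝒱.involPow (i + j) v := by
  suffices h : 𝒱.involPow i ∘ₗ 𝒱.involPow j = 𝒱.involPow (i + j) from LinearMap.congr_fun h v
  refine 𝒱.hom_ext fun l v hv => ?_
  rw [LinearMap.comp_apply, 𝒱.involPow_of_mem j hv, map_smul, 𝒱.involPow_of_mem i hv,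
    𝒱.involPow_of_mem _ hv, smul_smul, ← sgn_add, add_mul, add_comm]

theorem DGSpace.d_involPow (𝒱 : DGSpace k V) (i : ZMod 2) (v : V) :
    𝒱.d (𝒱.involPow i v) = sgn k i • 𝒱.involPow i (𝒱.d v) := by
  suffices h : 𝒱.d ∘ₗ 𝒱.involPow i = sgn k i • 𝒱.involPow i ∘ₗ 𝒱.d from LinearMap.congr_fun h v
  refine 𝒱.hom_ext fun l v hv => ?_
  have hsgn := (by decide : ∀ i l : ZMod 2, i * l = i + i * (l + 1)) i l
  rw [LinearMap.comp_apply, 𝒱.involPow_of_mem i hv, map_smul, LinearMap.smul_apply,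
    LinearMap.comp_apply, 𝒱.involPow_of_mem i (𝒱.d_mem l v hv), smul_smul, ← sgn_add, ← hsgn]

theorem DGSpace.proj_add_proj (𝒱 : DGSpace k V) : 𝒱.proj 0 + 𝒱.proj 1 = LinearMap.id :=
  𝒱.hom_ext fun l v hv => by
    rcases zmod_two_cases l with rfl | rfl
    · simp [𝒱.proj_self hv, 𝒱.proj_other (i := 1) hv]
    · simp [𝒱.proj_self hv, 𝒱.proj_other (i := 0) (by simpa using hv)]

end Space

/-! ### The algebra of formal functions -/

namespace Form

variable {k W : Type*} [Field k] [AddCommGroup W] [Module k W] {𝒲 : DGSpace k W}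

@[ext] theorem ext {f g : Form 𝒲} (h : ∀ l, f.1 l = g.1 l) : f = g := Subtype.ext (funext h)

theorem apply_cons (f : Form 𝒲) (w : W) (l : List W) : f.1 (w :: l) = (deriv 𝒲 w f).1 l := rfl

@[simp] theorem add_apply (f g : Form 𝒲) (l : List W) : (f + g).1 l = f.1 l + g.1 l := rfl

@[simp] theorem smul_apply (c : k) (f : Form 𝒲) (l : List W) : (c • f).1 l = c * f.1 l := rfl

@[simp] theorem zero_apply (l : List W) : (0 : Form 𝒲).1 l = 0 := rfl

/-- The partial derivative, as a linear function of the direction. -/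
def derivₗ (𝒲 : DGSpace k W) : W →ₗ[k] Form 𝒲 →ₗ[k] Form 𝒲 where
  toFun := deriv 𝒲
  map_add' u v := LinearMap.ext fun f => Subtype.ext (cut_add f.2 u v)
  map_smul' c u := LinearMap.ext fun f => Subtype.ext (cut_smul f.2 c u)

@[simp] theorem derivₗ_apply (w : W) : derivₗ 𝒲 w = deriv 𝒲 w := rfl

protected theorem deriv_add (u v : W) (f : Form 𝒲) :
    deriv 𝒲 (u + v) f = deriv 𝒲 u f + deriv 𝒲 v f :=
  LinearMap.congr_fun ((derivₗ 𝒲).map_add u v) f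

theorem deriv_smul (c : k) (u : W) (f : Form 𝒲) : deriv 𝒲 (c • u) f = c • deriv 𝒲 u f :=
  LinearMap.congr_fun ((derivₗ 𝒲).map_smul c u) f

theorem deriv_sum {ι : Type*} (s : Finset ι) (e : ι → W) (f : Form 𝒲) :
    deriv 𝒲 (∑ i ∈ s, e i) f = ∑ i ∈ s, deriv 𝒲 (e i) f := by
  simp only [← derivₗ_apply, map_sum, LinearMap.sum_apply]

theorem deriv_deriv {i j : ZMod 2} {u v : W} (hu : u ∈ 𝒲.part i) (hv : v ∈ 𝒲.part j)
    (f : Form 𝒲) : deriv 𝒲 v (deriv 𝒲 u f) = sgn k (i * j) • deriv 𝒲 u (deriv 𝒲 v f) :=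
  Subtype.ext (cut_cut f.2 hu hv)

theorem apply_cons_congr_of_span {S : Set W} (hS : Submodule.span k S = ⊤) {f g : Form 𝒲}
    {l : List W} (h : ∀ w ∈ S, (deriv 𝒲 w f).1 l = (deriv 𝒲 w g).1 l) (w : W) :
    f.1 (w :: l) = g.1 (w :: l) := by
  let evalDeriv (f : Form 𝒲) : W →ₗ[k] k :=
    LinearMap.proj l ∘ₗ (Form 𝒲).subtype ∘ₗ (derivₗ 𝒲).flip f
  exact LinearMap.congr_fun (LinearMap.ext_on hS h : evalDeriv f = evalDeriv g) w

theorem apply_cons_congr {f g : Form 𝒲} {l : List W}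
    (h : ∀ i, ∀ w ∈ 𝒲.part i, (deriv 𝒲 w f).1 l = (deriv 𝒲 w g).1 l) (w : W) :
    f.1 (w :: l) = g.1 (w :: l) :=
  apply_cons_congr_of_span 𝒲.span_homogeneous (fun w ⟨i, hw⟩ => h i w hw) w

/-- The `i`-th power of the parity involution `f ↦ (-1)^{|f|} f` of `Ŝ W^*`. -/
def involPow (𝒲 : DGSpace k W) (i : ZMod 2) : Form 𝒲 →ₗ[k] Form 𝒲 where
  toFun f := ⟨twist 𝒲 i f.1, twist_mem i f.2⟩
  map_add' f g := Subtype.ext (twist_add 𝒲 i f.1 g.1)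
  map_smul' c f := Subtype.ext (twist_smul 𝒲 i c f.1)

theorem involPow_apply (i : ZMod 2) (f : Form 𝒲) (l : List W) :
    (involPow 𝒲 i f).1 l = f.1 (l.map (𝒲.involPow i)) := by
  simp only [involPow, twist, LinearMap.coe_mk, AddHom.coe_mk, DGSpace.involPow]
  split_ifs <;> simp

@[simp] theorem involPow_zero (f : Form 𝒲) : involPow 𝒲 0 f = f := by
  ext l; simp [involPow_apply]

theorem involPow_nil (i : ZMod 2) (f : Form 𝒲) : (involPow 𝒲 i f).1 [] = f.1 [] := by
  simp [involPow_apply]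

theorem deriv_involPow (i : ZMod 2) {j : ZMod 2} {w : W} (hw : w ∈ 𝒲.part j) (f : Form 𝒲) :
    deriv 𝒲 w (involPow 𝒲 i f) = sgn k (i * j) • involPow 𝒲 i (deriv 𝒲 w f) :=
  Subtype.ext (cut_twist 𝒲 hw f.2)

theorem involPow_deriv (i : ZMod 2) {j : ZMod 2} {w : W} (hw : w ∈ 𝒲.part j) (f : Form 𝒲) :
    involPow 𝒲 i (deriv 𝒲 w f) = sgn k (i * j) • deriv 𝒲 w (involPow 𝒲 i f) := by
  rw [deriv_involPow i hw, smul_smul, sgn_mul_self, one_smul]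

theorem involPow_involPow (i j : ZMod 2) (f : Form 𝒲) :
    involPow 𝒲 i (involPow 𝒲 j f) = involPow 𝒲 (i + j) f := by
  ext l
  simp only [involPow_apply, List.map_map, Function.comp_def, 𝒲.involPow_involPow, add_comm j i]

instance : NonUnitalNonAssocRing (Form 𝒲) where
  __ := (Form 𝒲).addCommGroup
  mul := mul
  left_distrib f g g' := ext fun l => mulAux_add_right 𝒲 l f.1 g.1 g'.1
  right_distrib f f' g := ext fun l => mulAux_add_left 𝒲 l f.1 f'.1 g.1
  zero_mul f := ext fun l => by
    have h := mulAux_smul_left 𝒲 l (0 : k) 0 f.1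
    rwa [zero_smul, zero_mul] at h
  mul_zero f := ext fun l => mulAux_zero_right 𝒲 l f.1

instance : IsScalarTower k (Form 𝒲) (Form 𝒲) where
  smul_assoc c f g := ext fun l => mulAux_smul_left 𝒲 l c f.1 g.1

instance : SMulCommClass k (Form 𝒲) (Form 𝒲) where
  smul_comm c f g := ext fun l => (mulAux_smul_right 𝒲 l c f.1 g.1).symm

theorem mul_eq (f g : Form 𝒲) : mul f g = f * g := rfl

@[simp] theorem mul_nil (f g : Form 𝒲) : (f * g).1 [] = f.1 [] * g.1 [] := rfl

theorem deriv_mul {i : ZMod 2} {w : W} (hw : w ∈ 𝒲.part i) (f g : Form 𝒲) :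
    deriv 𝒲 w (f * g) = deriv 𝒲 w f * g + involPow 𝒲 i f * deriv 𝒲 w g :=
  ext fun l => mulAux_cons_homog 𝒲 hw l f.1 g.2

theorem involPow_mul (i : ZMod 2) (f g : Form 𝒲) :
    involPow 𝒲 i (f * g) = involPow 𝒲 i f * involPow 𝒲 i g := by
  ext l
  induction l generalizing f g with
  | nil => simp only [mul_nil, involPow_nil]
  | cons w l ih =>
    refine apply_cons_congr (fun j w hw => ?_) w
    simp only [deriv_involPow i hw, deriv_mul hw, map_add, smul_mul_assoc, mul_smul_comm,
      smul_add, involPow_involPow, add_comm i j, add_apply, smul_apply, ih]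

instance : One (Form 𝒲) where
  one := ⟨fun l => if l = [] then 1 else 0, by simp [Form]⟩

@[simp] theorem one_nil : (1 : Form 𝒲).1 [] = 1 := rfl

@[simp] theorem deriv_one (w : W) : deriv 𝒲 w 1 = 0 := rfl

@[simp] theorem involPow_one (i : ZMod 2) : involPow 𝒲 i 1 = 1 := by
  ext l
  rcases l with _ | ⟨w, l⟩
  · exact involPow_nil i 1
  · refine apply_cons_congr (fun j w hw => ?_) w
    rw [deriv_involPow i hw, deriv_one, map_zero, smul_zero]

instance : Ring (Form 𝒲) where
  mul_assoc f g h := by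
    ext l
    induction l generalizing f g h with
    | nil => simp only [mul_nil, mul_assoc]
    | cons w l ih =>
      refine apply_cons_congr (fun j w hw => ?_) w
      simp only [deriv_mul hw, add_mul, mul_add, involPow_mul, add_apply, ih, add_assoc]
  one_mul f := by
    ext l
    induction l generalizing f with
    | nil => rw [mul_nil, one_nil, one_mul]
    | cons w l ih =>
      refine apply_cons_congr (fun j w hw => ?_) w
      rw [deriv_mul hw, deriv_one, zero_mul, zero_add, involPow_one, ih]
  mul_one f := by
    ext l
    induction l generalizing f with
    | nil => rw [mul_nil, one_nil, mul_one]
    | cons w l ih =>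
      refine apply_cons_congr (fun j w hw => ?_) w
      rw [deriv_mul hw, deriv_one, mul_zero, add_zero, ih]

instance : Algebra k (Form 𝒲) := Algebra.ofModule smul_mul_assoc mul_smul_comm

@[simp] theorem lin_nil (x : Module.Dual k W) : (lin 𝒲 x).1 [] = 0 := rfl

@[simp] theorem deriv_lin (w : W) (x : Module.Dual k W) : deriv 𝒲 w (lin 𝒲 x) = x w • 1 := by
  ext l
  rw [← apply_cons]
  rcases l with _ | _
  · exact (mul_one (x w)).symm
  · exact (mul_zero (x w)).symm

theorem diff_nil (f : Form 𝒲) : (diff 𝒲 f).1 [] = 0 := rfl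

theorem deriv_diff {i : ZMod 2} {w : W} (hw : w ∈ 𝒲.part i) (f : Form 𝒲) :
    deriv 𝒲 w (diff 𝒲 f) = deriv 𝒲 (𝒲.d w) f + sgn k i • diff 𝒲 (deriv 𝒲 w f) := by
  ext l
  change f.1 (𝒲.d w :: l) + diffAux 𝒲 l (cut (𝒲.invol w) f.1) =
    f.1 (𝒲.d w :: l) + sgn k i * diffAux 𝒲 l (cut w f.1)
  rw [𝒲.invol_of_mem hw, cut_smul f.2, diffAux_smul]

theorem involPow_diff (i : ZMod 2) (f : Form 𝒲) :
    involPow 𝒲 i (diff 𝒲 f) = sgn k i • diff 𝒲 (involPow 𝒲 i f) := by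
  ext l
  induction l generalizing f with
  | nil => simp [involPow_nil, diff_nil]
  | cons w l ih =>
    refine apply_cons_congr (fun j w hw => ?_) w
    simp only [deriv_involPow i hw, deriv_diff hw, map_add, map_smul, smul_apply, add_apply, ih,
      involPow_deriv i (𝒲.d_mem j w hw), mul_add, sgn_add, mul_one]
    linear_combination (sgn k i * (deriv 𝒲 (𝒲.d w) (involPow 𝒲 i f)).1 l) *
      sgn_mul_self (k := k) (i * j)

theorem diff_mul (f g : Form 𝒲) :
    diff 𝒲 (f * g) = diff 𝒲 f * g + involPow 𝒲 1 f * diff 𝒲 g := by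
  ext l
  induction l generalizing f g with
  | nil => simp [diff_nil]
  | cons w l ih =>
    refine apply_cons_congr (fun j w hw => ?_) w
    simp only [deriv_diff hw, deriv_mul hw, deriv_mul (𝒲.d_mem j w hw), map_add, add_apply,
      smul_apply, ih, deriv_involPow 1 hw, add_mul, mul_add, smul_mul_assoc, mul_smul_comm,
      involPow_involPow, involPow_diff j, one_mul, add_comm 1 j]
    ring

end Form

section Parity

variable {k W : Type*} [Field k] [AddCommGroup W] [Module k W] {𝒲 : DGSpace k W}
  {f g : Form 𝒲} {q : ZMod 2}

theorem HasParity.deriv (h : HasParity q f) {i : ZMod 2} {w : W} (hw : w ∈ 𝒲.part i) :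
    HasParity (q + i) (deriv 𝒲 w f) := fun l s hs hsum => by
  refine h (w :: l) (i :: s) (.cons hw hs) fun hq => hsum ?_
  rw [← hq, List.sum_cons, add_right_comm, CharTwo.add_self_eq_zero, zero_add]

theorem HasParity.smul (c : k) (h : HasParity q f) : HasParity q (c • f) := fun l s hs hq => by
  rw [Form.smul_apply, h l s hs hq, mul_zero]

theorem HasParity.involPow (h : HasParity q f) (i : ZMod 2) :
    Form.involPow 𝒲 i f = sgn k (i * q) • f := by
  ext l
  induction l generalizing f q with
  | nil =>
    rcases zmod_two_cases q with rfl | rfl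
    · simp [Form.involPow_nil]
    · simp [Form.involPow_nil, h [] [] .nil zero_ne_one]
  | cons w l ih =>
    refine Form.apply_cons_congr (fun j w hw => ?_) w
    rw [Form.deriv_involPow i hw, Form.smul_apply, ih (h.deriv hw), map_smul, Form.smul_apply,
      Form.smul_apply, mul_add, sgn_add, mul_assoc, mul_left_comm, sgn_mul_cancel]

theorem Form.involPow_apply_of_forall₂ (f : Form 𝒲) {l : List W} {s : List (ZMod 2)}
    (h : List.Forall₂ (fun w i => w ∈ 𝒲.part i) l s) (i : ZMod 2) :
    (Form.involPow 𝒲 i f).1 l = sgn k (i * s.sum) * f.1 l := by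
  induction h generalizing f with
  | nil => simp [Form.involPow_nil]
  | cons hw _ ih =>
    rw [Form.apply_cons, Form.deriv_involPow i hw, Form.smul_apply, ih, List.sum_cons, mul_add,
      sgn_add, Form.apply_cons, mul_assoc]

theorem hasParity_iff [CharZero k] : HasParity q f ↔ Form.involPow 𝒲 1 f = sgn k q • f := by
  refine ⟨fun h => by simpa using h.involPow 1, fun h l s hs hq => ?_⟩
  have hsgn := Form.involPow_apply_of_forall₂ f hs 1
  rw [h, Form.smul_apply, one_mul, mul_eq_mul_right_iff] at hsgn
  exact hsgn.resolve_left fun h => hq (sgn_injective h).symm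

theorem Form.exists_hasParity_add [CharZero k] (f : Form 𝒲) :
    ∃ g h, HasParity 0 g ∧ HasParity 1 h ∧ g + h = f := by
  refine ⟨(1 / 2 : k) • (f + Form.involPow 𝒲 1 f), (1 / 2 : k) • (f - Form.involPow 𝒲 1 f),
    hasParity_iff.mpr ?_, hasParity_iff.mpr ?_, by module⟩
  · simp only [map_smul, map_add, Form.involPow_involPow, CharTwo.add_self_eq_zero,
      Form.involPow_zero, sgn_zero, one_smul, add_comm]
  · simp only [map_smul, map_sub, Form.involPow_involPow, CharTwo.add_self_eq_zero,
      Form.involPow_zero, sgn_one]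
    module

theorem Form.hom_ext [CharZero k] {U : Type*} [AddCommGroup U] [Module k U]
    {D E : Form 𝒲 →ₗ[k] U} (h : ∀ q f, HasParity q f → D f = E f) : D = E := by
  refine LinearMap.ext fun f => ?_
  obtain ⟨a, b, ha, hb, rfl⟩ := Form.exists_hasParity_add f
  rw [map_add, map_add, h 0 a ha, h 1 b hb]

theorem HasParity.mul_comm (f : Form 𝒲) (hg : HasParity q g) :
    f * g = g * Form.involPow 𝒲 q f := by
  ext l
  induction l generalizing f g q with
  | nil => rw [Form.mul_nil, Form.mul_nil, Form.involPow_nil, _root_.mul_comm]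
  | cons w l ih =>
    refine Form.apply_cons_congr (fun j w hw => ?_) w
    have hj : j + (q + j) = q := (by decide : ∀ q j : ZMod 2, j + (q + j) = q) q j
    rw [Form.deriv_mul hw, Form.deriv_mul hw, Form.add_apply, Form.add_apply, ih _ hg,
      ih _ (hg.deriv hw), hg.involPow, Form.deriv_involPow q hw, Form.involPow_involPow,
      smul_mul_assoc, mul_smul_comm, smul_smul, _root_.mul_comm j q, sgn_mul_self, one_smul,
      add_comm (q + j), hj, add_comm]

theorem hasParity_lin {x : Module.Dual k W} (h : ∀ w ∈ 𝒲.part (q + 1), x w = 0) :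
    HasParity q (lin 𝒲 x) := by
  rintro _ _ (_ | ⟨hw, _ | _⟩) hq
  · rfl
  · refine h _ ?_
    rwa [← (by decide : ∀ i q : ZMod 2, i ≠ q → i = q + 1) _ q (by simpa using hq)]
  · rfl

end Parity

section Order

variable {k W : Type*} [Field k] [AddCommGroup W] [Module k W] {𝒲 : DGSpace k W}
  {f g : Form 𝒲} {m n : ℕ}

theorem AtLeast.deriv (h : AtLeast n f) (w : W) : AtLeast (n - 1) (deriv 𝒲 w f) :=
  fun l hl => h (w :: l) (Nat.add_lt_of_lt_sub hl)

theorem AtLeast.involPow (h : AtLeast n f) (i : ZMod 2) : AtLeast n (Form.involPow 𝒲 i f) :=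
  fun l hl => by rw [Form.involPow_apply, h _ (by rwa [List.length_map])]

theorem AtLeast.mono (h : AtLeast n f) (hmn : m ≤ n) : AtLeast m f :=
  fun l hl => h l (hl.trans_le hmn)

theorem AtLeast.smul (c : k) (h : AtLeast n f) : AtLeast n (c • f) :=
  fun l hl => by rw [Form.smul_apply, h l hl, mul_zero]

theorem AtLeast.add (hf : AtLeast n f) (hg : AtLeast n g) : AtLeast n (f + g) :=
  fun l hl => by rw [Form.add_apply, hf l hl, hg l hl, add_zero]

theorem AtLeast.sum {ι : Type*} (s : Finset ι) {f : ι → Form 𝒲} (hf : ∀ i ∈ s, AtLeast n (f i)) :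
    AtLeast n (∑ i ∈ s, f i) :=
  Finset.sum_induction f (AtLeast n) (fun _ _ => AtLeast.add) (fun _ _ => rfl) hf

theorem AtLeast.mul (hf : AtLeast m f) (hg : AtLeast n g) : AtLeast (m + n) (f * g) := by
  intro l hl
  induction l generalizing f g m n with
  | nil =>
    rw [List.length_nil, Nat.add_pos_iff_pos_or_pos] at hl
    rcases hl with hm | hn
    · rw [Form.mul_nil, hf [] hm, zero_mul]
    · rw [Form.mul_nil, hg [] hn, mul_zero]
  | cons w l ih =>
    refine Form.apply_cons_congr (g := 0) (fun i w hw => ?_) w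
    rw [List.length_cons] at hl
    rw [Form.deriv_mul hw, Form.add_apply, ih (hf.deriv w) hg (by lia),
      ih (hf.involPow i) (hg.deriv w) (by lia), add_zero, map_zero, Form.zero_apply]

end Order

/-! ### Homogeneous coordinates -/

/-- Homogeneous vectors `e i` of parity `p i` and coordinate functions `x i` of the same parity
with `w = ∑ i, x i w • e i` for all `w`. The `e i` need not be linearly independent. -/
structure HomogeneousFrame {k W : Type*} [Field k] [AddCommGroup W] [Module k W]
    (𝒲 : DGSpace k W) (ι : Type*) [Fintype ι] where
  p : ι → ZMod 2
  e : ι → W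
  x : ι → Module.Dual k W
  e_mem : ∀ i, e i ∈ 𝒲.part (p i)
  x_eq_zero : ∀ i, ∀ w ∈ 𝒲.part (p i + 1), x i w = 0
  sum_eq : ∀ w, ∑ i, x i w • e i = w

section Frames

variable {k W : Type*} [Field k] [AddCommGroup W] [Module k W] {𝒲 : DGSpace k W}

theorem DGSpace.sum_coord_smul_finBasis [FiniteDimensional k W] (𝒲 : DGSpace k W) (i : ZMod 2)
    (w : W) :
    ∑ j, ((Module.finBasis k (𝒲.part i)).coord j ∘ₗ 𝒲.projOnto i) w •
      (Module.finBasis k (𝒲.part i) j : W) = 𝒲.proj i w := by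
  have h := congrArg (𝒲.part i).subtype
    ((Module.finBasis k (𝒲.part i)).sum_repr (𝒲.projOnto i w))
  rwa [map_sum] at h

/-- The frame given by the bases of the even and of the odd part that occur in the definition of
the divergence. -/
def DGSpace.stdFrame [FiniteDimensional k W] (𝒲 : DGSpace k W) :
    HomogeneousFrame 𝒲 (Σ i : ZMod 2, Fin (Module.finrank k (𝒲.part i))) where
  p a := a.1
  e a := Module.finBasis k (𝒲.part a.1) a.2
  x a := (Module.finBasis k (𝒲.part a.1)).coord a.2 ∘ₗ 𝒲.projOnto a.1
  e_mem a := (Module.finBasis k (𝒲.part a.1) a.2).2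
  x_eq_zero a w hw := by
    have h : 𝒲.projOnto a.1 w = 0 := Subtype.ext (𝒲.proj_other hw)
    rw [LinearMap.comp_apply, h, map_zero]
  sum_eq w := by
    rw [Fintype.sum_sigma]
    simp only [DGSpace.sum_coord_smul_finBasis]
    exact (Fin.sum_univ_two fun i : ZMod 2 => 𝒲.proj i w).trans
      (LinearMap.congr_fun 𝒲.proj_add_proj w)

variable {ι : Type*} [Fintype ι] (B : HomogeneousFrame 𝒲 ι)

theorem HomogeneousFrame.dual_eq_sum (y : Module.Dual k W) : y = ∑ i, y (B.e i) • B.x i := by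
  refine LinearMap.ext fun w => ?_
  conv_lhs => rw [← B.sum_eq w]
  simp only [map_sum, map_smul, LinearMap.sum_apply, LinearMap.smul_apply, smul_eq_mul, mul_comm]

theorem HomogeneousFrame.x_comp_involPow (i : ι) (j : ZMod 2) :
    B.x i ∘ₗ 𝒲.involPow j = sgn k (j * B.p i) • B.x i :=
  𝒲.hom_ext fun l w hw => by
    rw [LinearMap.comp_apply, 𝒲.involPow_of_mem j hw, map_smul, LinearMap.smul_apply]
    rcases eq_or_ne l (B.p i) with rfl | hl
    · rfl
    · obtain rfl := (by decide : ∀ a b : ZMod 2, a ≠ b → a = b + 1) _ _ hl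
      rw [B.x_eq_zero i w hw, smul_zero, smul_zero]

theorem HomogeneousFrame.hasParity_lin (i : ι) : HasParity (B.p i) (lin 𝒲 (B.x i)) :=
  SuperLInfty.hasParity_lin (B.x_eq_zero i)

theorem HomogeneousFrame.deriv_eq_sum (w : W) (f : Form 𝒲) :
    deriv 𝒲 w f = ∑ i, B.x i w • deriv 𝒲 (B.e i) f := by
  conv_lhs => rw [← B.sum_eq w, Form.deriv_sum]
  simp only [Form.deriv_smul]

/-- The operator multiplying the homogeneous polynomials of degree `n` by `c n`. -/
def Form.rescale (c : ℕ → k) : Form 𝒲 →ₗ[k] Form 𝒲 where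
  toFun f := ⟨fun l => c l.length * f.1 l, by
    obtain ⟨hadd, hsmul, hswap⟩ := f.2
    refine ⟨fun l₁ l₂ u v => ?_, fun l₁ l₂ a u => ?_, fun l₁ l₂ i j u hu v hv => ?_⟩
    · simp only [hadd, List.length_append, List.length_cons, mul_add]
    · simp only [hsmul, List.length_append, List.length_cons, mul_left_comm]
    · simp only [hswap l₁ l₂ i j u hu v hv, List.length_append, List.length_cons, mul_left_comm]⟩
  map_add' f g := Form.ext fun l => mul_add (c l.length) (f.1 l) (g.1 l)
  map_smul' a f := Form.ext fun l => mul_left_comm (c l.length) a (f.1 l)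

theorem Form.rescale_apply (c : ℕ → k) (f : Form 𝒲) (l : List W) :
    (rescale c f).1 l = c l.length * f.1 l := rfl

theorem HomogeneousFrame.deriv_sum_lin_mul_deriv {j : ZMod 2} {w : W} (hw : w ∈ 𝒲.part j)
    (f : Form 𝒲) :
    deriv 𝒲 w (∑ i, lin 𝒲 (B.x i) * deriv 𝒲 (B.e i) f) =
      deriv 𝒲 w f + ∑ i, lin 𝒲 (B.x i) * deriv 𝒲 (B.e i) (deriv 𝒲 w f) := by
  rw [map_sum]
  conv_rhs => rw [B.deriv_eq_sum w f, ← Finset.sum_add_distrib]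
  refine Finset.sum_congr rfl fun i _ => ?_
  rw [Form.deriv_mul hw, Form.deriv_lin, smul_one_mul, (B.hasParity_lin i).involPow,
    Form.deriv_deriv (B.e_mem i) hw, smul_mul_smul_comm, mul_comm j, sgn_mul_self, one_smul,
    ← B.deriv_eq_sum w f]

theorem HomogeneousFrame.euler (f : Form 𝒲) :
    ∑ i, lin 𝒲 (B.x i) * deriv 𝒲 (B.e i) f = Form.rescale (fun n => (n : k)) f := by
  ext l
  induction l generalizing f with
  | nil =>
    rw [Form.rescale_apply, List.length_nil, Nat.cast_zero, zero_mul]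
    refine Finset.sum_induction _ (fun g : Form 𝒲 => g.1 [] = 0) (fun g h hg hh => ?_) rfl
      fun i _ => ?_
    · rw [Form.add_apply, hg, hh, add_zero]
    · rw [Form.mul_nil, Form.lin_nil, zero_mul]
  | cons w l ih =>
    refine Form.apply_cons_congr (fun j w hw => ?_) w
    rw [B.deriv_sum_lin_mul_deriv hw, Form.add_apply, ih, Form.rescale_apply, ← Form.apply_cons,
      ← Form.apply_cons, Form.rescale_apply, List.length_cons, Nat.cast_succ]
    ring

theorem HomogeneousFrame.hadamard [CharZero k] (f : Form 𝒲) :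
    f = f.1 [] • 1 +
      ∑ i, lin 𝒲 (B.x i) * deriv 𝒲 (B.e i) (Form.rescale (fun n => (n : k)⁻¹) f) := by
  rw [B.euler]
  ext l
  rw [Form.add_apply, Form.smul_apply, Form.rescale_apply, Form.rescale_apply]
  rcases l with _ | ⟨w, l⟩
  · simp
  · have h : ((w :: l).length : k) ≠ 0 := Nat.cast_ne_zero.mpr (Nat.succ_ne_zero l.length)
    rw [mul_inv_cancel_left₀ h, show (1 : Form 𝒲).1 (w :: l) = 0 from rfl, mul_zero, zero_add]

end Frames

/-! ### Derivations -/

section Derivations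

variable {k W : Type*} [Field k] [AddCommGroup W] [Module k W] {𝒲 : DGSpace k W}
  {p q : ZMod 2} {D E : Form 𝒲 →ₗ[k] Form 𝒲}

/-- Derivations of parity `p` of `Ŝ W^*`, described by identities for arbitrary elements: the signs
that involve the parity of an element are expressed through the parity involution. -/
structure IsSuperderivation (p : ZMod 2) (D : Form 𝒲 →ₗ[k] Form 𝒲) : Prop where
  involPow_map : ∀ i f, Form.involPow 𝒲 i (D f) = sgn k (i * p) • D (Form.involPow 𝒲 i f)
  leibniz : ∀ f g, D (f * g) = D f * g + Form.involPow 𝒲 p f * D g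

theorem IsDerivation.isSuperderivation [CharZero k] (h : IsDerivation p D) :
    IsSuperderivation p D where
  involPow_map i := by
    suffices e : Form.involPow 𝒲 i ∘ₗ D = sgn k (i * p) • D ∘ₗ Form.involPow 𝒲 i from
      LinearMap.congr_fun e
    refine Form.hom_ext fun q f hf => ?_
    rw [LinearMap.comp_apply, LinearMap.smul_apply, LinearMap.comp_apply,
      (h.parity q f hf).involPow, hf.involPow, map_smul, smul_smul, mul_add, sgn_add, mul_comm]
  leibniz f g := by
    suffices e : D ∘ₗ LinearMap.mulRight k g =
        LinearMap.mulRight k g ∘ₗ D + LinearMap.mulRight k (D g) ∘ₗ Form.involPow 𝒲 p from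
      LinearMap.congr_fun e f
    refine Form.hom_ext fun q f hf => ?_
    simp only [LinearMap.comp_apply, LinearMap.add_apply, LinearMap.mulRight_apply]
    rw [hf.involPow, smul_mul_assoc]
    exact h.leibniz q f g hf

theorem IsSuperderivation.hasParity [CharZero k] (h : IsSuperderivation p D) {f : Form 𝒲}
    (hf : HasParity q f) : HasParity (q + p) (D f) := by
  rw [hasParity_iff, h.involPow_map, hf.involPow, map_smul, smul_smul, one_mul, one_mul, add_comm,
    sgn_add]

theorem IsSuperderivation.isDerivation [CharZero k] (h : IsSuperderivation p D) :
    IsDerivation p D where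
  parity _ _ hf := h.hasParity hf
  leibniz q f g hf := by
    simp only [Form.mul_eq]
    rw [h.leibniz, hf.involPow, smul_mul_assoc]

theorem isSuperderivation_diff : IsSuperderivation 1 (diff 𝒲) where
  involPow_map i f := by rw [Form.involPow_diff, mul_one]
  leibniz := Form.diff_mul

namespace IsSuperderivation

theorem map_one (h : IsSuperderivation p D) : D 1 = 0 := by
  simpa using h.leibniz 1 1

theorem add (hD : IsSuperderivation p D) (hE : IsSuperderivation p E) :
    IsSuperderivation p (D + E) where
  involPow_map i f := by
    simp only [LinearMap.add_apply, map_add, hD.involPow_map, hE.involPow_map, smul_add]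
  leibniz f g := by
    simp only [LinearMap.add_apply, hD.leibniz, hE.leibniz, add_mul, mul_add]
    abel

theorem smul (c : k) (hD : IsSuperderivation p D) : IsSuperderivation p (c • D) where
  involPow_map i f := by
    rw [LinearMap.smul_apply, LinearMap.smul_apply, map_smul, hD.involPow_map, smul_comm]
  leibniz f g := by
    simp only [LinearMap.smul_apply, hD.leibniz, smul_mul_assoc, mul_smul_comm, smul_add]

theorem bracket_one_one (hD : IsSuperderivation 1 D) (hE : IsSuperderivation 1 E) :
    IsSuperderivation 0 (bracket 1 1 D E) where
  involPow_map i f := by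
    simp only [bracket, LinearMap.add_apply, LinearMap.comp_apply, map_add,
      map_smul, hD.involPow_map, hE.involPow_map, mul_one, sgn_one, neg_neg, one_smul, smul_smul,
      sgn_mul_self, mul_zero, sgn_zero]
  leibniz f g := by
    simp only [bracket, LinearMap.add_apply, LinearMap.comp_apply, mul_one,
      sgn_one, neg_neg, one_smul, hD.leibniz, hE.leibniz, map_add, add_mul, mul_add,
      hD.involPow_map, hE.involPow_map, Form.involPow_involPow, CharTwo.add_self_eq_zero,
      Form.involPow_zero, neg_smul, neg_mul]
    abel

end IsSuperderivation

section Coordinates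

variable {ι : Type*} [Fintype ι] (B : HomogeneousFrame 𝒲 ι)

theorem HomogeneousFrame.eq_zero_of_map_lin [CharZero k] (hD : IsSuperderivation p D)
    (h : ∀ i, D (lin 𝒲 (B.x i)) = 0) : D = 0 := by
  have hlin (x : Module.Dual k W) : AtLeast 1 (lin 𝒲 x) := fun l hl => by
    rw [List.eq_nil_of_length_eq_zero (Nat.lt_one_iff.mp hl), Form.lin_nil]
  have hAtLeast (n : ℕ) (f : Form 𝒲) : AtLeast n (D f) := by
    induction n generalizing f with
    | zero => exact fun l hl => absurd hl l.length.not_lt_zero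
    | succ n ih =>
      rw [B.hadamard f, map_add, map_smul, hD.map_one, smul_zero, zero_add, map_sum, add_comm]
      refine AtLeast.sum _ fun i _ => ?_
      rw [hD.leibniz, h, zero_mul, zero_add]
      exact ((hlin (B.x i)).involPow p).mul (ih _)
  exact LinearMap.ext fun f => Form.ext fun l => hAtLeast _ f l l.length.lt_succ_self

theorem HomogeneousFrame.ext_of_map_lin [CharZero k] (hD : IsSuperderivation p D)
    (hE : IsSuperderivation p E) (h : ∀ i, D (lin 𝒲 (B.x i)) = E (lin 𝒲 (B.x i))) : D = E := by
  have hsub := B.eq_zero_of_map_lin (hD.add (hE.smul (-1))) fun i => by simp [h]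
  exact sub_eq_zero.mp (by rw [← hsub]; module)

/-- The vector field `∑ c_i ∂_i`. -/
def HomogeneousFrame.field (c : ι → Form 𝒲) : Form 𝒲 →ₗ[k] Form 𝒲 :=
  ∑ i, LinearMap.mulLeft k (c i) ∘ₗ deriv 𝒲 (B.e i)

theorem HomogeneousFrame.field_apply (c : ι → Form 𝒲) (f : Form 𝒲) :
    B.field c f = ∑ i, c i * deriv 𝒲 (B.e i) f := by
  simp [field]

theorem HomogeneousFrame.isSuperderivation_field {c : ι → Form 𝒲}
    (hc : ∀ i, HasParity (B.p i + p) (c i)) : IsSuperderivation p (B.field c) where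
  involPow_map j f := by
    simp only [field_apply, map_sum, Finset.smul_sum]
    refine Finset.sum_congr rfl fun i _ => ?_
    have hsgn := (by decide : ∀ j a p : ZMod 2, j * (a + p) + j * a = j * p) j (B.p i) p
    rw [Form.involPow_mul, (hc i).involPow, Form.involPow_deriv j (B.e_mem i), smul_mul_smul_comm,
      ← sgn_add, hsgn]
  leibniz f g := by
    simp only [field_apply, Finset.sum_mul, Finset.mul_sum, ← Finset.sum_add_distrib]
    refine Finset.sum_congr rfl fun i _ => ?_
    rw [Form.deriv_mul (B.e_mem i), mul_add, ← mul_assoc, ← mul_assoc (Form.involPow 𝒲 p f),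
      (hc i).mul_comm, Form.involPow_involPow, add_assoc, CharTwo.add_self_eq_zero, add_zero,
      mul_assoc, mul_assoc]

theorem HomogeneousFrame.field_lin (c : ι → Form 𝒲) (y : Module.Dual k W) :
    B.field c (lin 𝒲 y) = ∑ i, y (B.e i) • c i := by
  simp only [field_apply, Form.deriv_lin, mul_smul_one]

theorem HomogeneousFrame.map_lin_eq_sum (D : Form 𝒲 →ₗ[k] Form 𝒲) (y : Module.Dual k W) :
    D (lin 𝒲 y) = ∑ i, y (B.e i) • D (lin 𝒲 (B.x i)) := by
  conv_lhs => rw [B.dual_eq_sum y]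
  simp only [map_sum, map_smul]

theorem HomogeneousFrame.eq_field [CharZero k] (hD : IsSuperderivation p D) :
    D = B.field fun i => D (lin 𝒲 (B.x i)) := by
  refine B.ext_of_map_lin hD
    (B.isSuperderivation_field fun i => hD.hasParity (B.hasParity_lin i)) fun i => ?_
  rw [B.field_lin, ← B.map_lin_eq_sum]

theorem HomogeneousFrame.apply_eq_sum [CharZero k] (hD : IsSuperderivation p D) (f : Form 𝒲) :
    D f = ∑ i, D (lin 𝒲 (B.x i)) * deriv 𝒲 (B.e i) f := by
  conv_lhs => rw [B.eq_field hD, B.field_apply]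

theorem HomogeneousFrame.divergence_eq_sum [FiniteDimensional k W] (D : Form 𝒲 →ₗ[k] Form 𝒲) :
    divergence 1 D = ∑ i, deriv 𝒲 (B.e i) (D (lin 𝒲 (B.x i))) := by
  have hstd : divergence 1 D =
      ∑ a, deriv 𝒲 (𝒲.stdFrame.e a) (D (lin 𝒲 (𝒲.stdFrame.x a))) := by
    rw [divergence, Fintype.sum_sigma]
    refine Finset.sum_congr rfl fun i _ => Finset.sum_congr rfl fun j _ => ?_
    rw [(by decide : ∀ i : ZMod 2, (1 + i) * i = 0) i, sgn_zero, one_smul]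
    rfl
  rw [hstd, Finset.sum_congr rfl fun a _ => B.deriv_eq_sum (𝒲.stdFrame.e a) _, Finset.sum_comm]
  refine Finset.sum_congr rfl fun i _ => ?_
  rw [𝒲.stdFrame.map_lin_eq_sum D (B.x i), map_sum]
  simp only [map_smul]

theorem lin_apply_taylor [FiniteDimensional k W] (D : Form 𝒲 →ₗ[k] Form 𝒲) (l : List W)
    (y : Module.Dual k W) : y (taylor D l) = (D (lin 𝒲 y)).1 l := by
  rw [taylor, Module.apply_evalEquiv_symm_apply]
  rfl

end Coordinates

end Derivations

/-! ### Commutative dg algebras -/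

section Algebra

variable {k A : Type*} [Field k] [Ring A] [Algebra k A] (𝒜 : CDGA k A)

theorem CDGA.involPow_mul (i : ZMod 2) (a b : A) :
    𝒜.involPow i (a * b) = 𝒜.involPow i a * 𝒜.involPow i b := by
  suffices h : (LinearMap.mul k A).compr₂ (𝒜.involPow i) =
      (LinearMap.mul k A).compl₁₂ (𝒜.involPow i) (𝒜.involPow i) from
    LinearMap.congr_fun₂ h a b
  refine 𝒜.hom_ext fun p a ha => 𝒜.hom_ext fun q b hb => ?_
  simp only [LinearMap.compr₂_apply, LinearMap.compl₁₂_apply, LinearMap.mul_apply']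
  rw [𝒜.involPow_of_mem i ha, 𝒜.involPow_of_mem i hb,
    𝒜.involPow_of_mem i (𝒜.mul_mem p q a ha b hb), smul_mul_smul_comm, mul_add, sgn_add]

theorem CDGA.involPow_one_apply_one (i : ZMod 2) : 𝒜.involPow i 1 = 1 := by
  rw [𝒜.involPow_of_mem i 𝒜.one_mem, mul_zero, sgn_zero, one_smul]

theorem CDGA.d_mul (a b : A) : 𝒜.d (a * b) = 𝒜.d a * b + 𝒜.involPow 1 a * 𝒜.d b := by
  suffices h : 𝒜.d ∘ₗ LinearMap.mulRight k b =
      LinearMap.mulRight k b ∘ₗ 𝒜.d + LinearMap.mulRight k (𝒜.d b) ∘ₗ 𝒜.involPow 1 from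
    LinearMap.congr_fun h a
  refine 𝒜.hom_ext fun p a ha => ?_
  simp [𝒜.leibniz p a ha, 𝒜.involPow_of_mem 1 ha]

theorem CDGA.mul_eq_involPow_mul {i : ZMod 2} {a : A} (ha : a ∈ 𝒜.part i) (b : A) :
    a * b = 𝒜.involPow i b * a := by
  suffices h : LinearMap.mulLeft k a = LinearMap.mulRight k a ∘ₗ 𝒜.involPow i from
    LinearMap.congr_fun h b
  refine 𝒜.hom_ext fun q b hb => ?_
  simp [𝒜.mul_comm i q a ha b hb, 𝒜.involPow_of_mem i hb]

theorem CDGA.d_one : 𝒜.d (1 : A) = 0 := by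
  have h := 𝒜.d_mul 1 1
  rw [𝒜.involPow_one_apply_one, one_mul, mul_one, one_mul] at h
  exact left_eq_add.mp h

theorem CDGA.d_idempotent {e : A} (he : e ∈ 𝒜.part 0) (hee : IsIdempotentElem e) :
    𝒜.d e = 0 := by
  have hleibniz : 𝒜.d e = 𝒜.d e * e + e * 𝒜.d e := by
    simpa [hee.eq] using 𝒜.leibniz 0 e he e
  have hcomm : 𝒜.d e * e = e * 𝒜.d e := by
    simpa using 𝒜.mul_comm _ _ _ (𝒜.d_mem 0 e he) _ he
  have hmul : e * 𝒜.d e = e * 𝒜.d e + e * 𝒜.d e := by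
    conv_lhs => rw [hleibniz, hcomm, mul_add, ← _root_.mul_assoc, hee.eq]
  rw [hleibniz, hcomm, left_eq_add.mp hmul, add_zero]

/-- The action `a ↦ (φ ↦ φ (a * (-1)^{β |·|} ·))` of `A` on its dual. The twist by `β` is the Koszul
sign of moving a vector of parity `β` past the argument. -/
def CDGA.dualAct (β : ZMod 2) : A →ₗ[k] Module.Dual k A →ₗ[k] Module.Dual k A :=
  LinearMap.mk₂ k (fun a φ => φ ∘ₗ LinearMap.mulLeft k a ∘ₗ 𝒜.involPow β)
    (fun a b φ => by ext; simp [add_mul]) (fun c a φ => by ext; simp)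
    (fun a φ ψ => by ext; simp) (fun c a φ => by ext; simp)

theorem CDGA.dualAct_apply (β : ZMod 2) (a : A) (φ : Module.Dual k A) (b : A) :
    𝒜.dualAct β a φ b = φ (a * 𝒜.involPow β b) := rfl

variable {𝒜}

variable (𝒜) in
theorem CDGA.dualAct_apply_comp_involPow (β i : ZMod 2) (a : A) (φ : Module.Dual k A) :
    𝒜.dualAct β a φ ∘ₗ 𝒜.involPow i = 𝒜.dualAct (β + i) a φ := by
  ext b
  simp only [LinearMap.comp_apply, 𝒜.dualAct_apply, 𝒜.involPow_involPow]

theorem CDGA.dualAct_comp_involPow {α : ZMod 2} (β i : ZMod 2) {a : A} (ha : a ∈ 𝒜.part α)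
    (φ : Module.Dual k A) :
    𝒜.dualAct β a (φ ∘ₗ 𝒜.involPow i) = sgn k (i * α) • 𝒜.dualAct (β + i) a φ := by
  ext b
  simp [𝒜.dualAct_apply, 𝒜.involPow_mul, 𝒜.involPow_of_mem i ha, 𝒜.involPow_involPow,
    add_comm β i]

theorem CDGA.dualAct_comp_d {α : ZMod 2} (β : ZMod 2) {a : A} (ha : a ∈ 𝒜.part α)
    (φ : Module.Dual k A) :
    𝒜.dualAct β a (φ ∘ₗ 𝒜.d) =
      𝒜.dualAct β (𝒜.d a) φ + sgn k (α + β) • 𝒜.dualAct β a φ ∘ₗ 𝒜.d := by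
  ext b
  simp [𝒜.dualAct_apply, 𝒜.d_mul, 𝒜.d_involPow, 𝒜.involPow_of_mem 1 ha, add_comm α β, sgn_add,
    _root_.mul_assoc]

variable (𝒜) in
theorem CDGA.dualAct_mul_involPow (β β' : ZMod 2) (a b : A) (φ : Module.Dual k A) :
    𝒜.dualAct β' (a * 𝒜.involPow β b) φ = 𝒜.dualAct (β' + β) b (𝒜.dualAct β a φ) := by
  ext c
  have hβ := (by decide : ∀ β β' : ZMod 2, β + (β' + β) = β') β β'
  simp only [𝒜.dualAct_apply, 𝒜.involPow_mul, 𝒜.involPow_involPow, hβ, _root_.mul_assoc]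

theorem CDGA.dualAct_dualAct_involPow {α : ZMod 2} (β β' : ZMod 2) {a : A} (ha : a ∈ 𝒜.part α)
    (b : A) (φ : Module.Dual k A) :
    𝒜.dualAct β a (𝒜.dualAct β' (𝒜.involPow (α + β) b) φ) =
      sgn k (β' * α) • 𝒜.dualAct β' b (𝒜.dualAct β a φ) := by
  ext c
  have hcomm : 𝒜.involPow (α + β) b * a = a * 𝒜.involPow β b := by
    rw [𝒜.mul_eq_involPow_mul ha, 𝒜.involPow_involPow]
  simp only [LinearMap.smul_apply, 𝒜.dualAct_apply, 𝒜.involPow_mul, 𝒜.involPow_of_mem β' ha,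
    𝒜.involPow_involPow, smul_mul_assoc, mul_smul_comm, map_smul, ← _root_.mul_assoc, hcomm,
    add_comm β β']

theorem CDGA.dualAct_comm {α α' : ZMod 2} (β β' : ZMod 2) {a a' : A} (ha : a ∈ 𝒜.part α)
    (ha' : a' ∈ 𝒜.part α') (φ : Module.Dual k A) :
    𝒜.dualAct β' a' (𝒜.dualAct β a φ) =
      sgn k (β * α' + α * α' + β' * α) • 𝒜.dualAct β a (𝒜.dualAct β' a' φ) := by
  have hinvol : a = sgn k ((α' + β') * α) • 𝒜.involPow (α' + β') a := by
    rw [𝒜.involPow_of_mem _ ha, smul_smul, ← sgn_add, CharTwo.add_self_eq_zero, sgn_zero, one_smul]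
  have hsgn := (by decide : ∀ α α' β β' : ZMod 2,
    (α' + β') * α + β * α' = β * α' + α * α' + β' * α) α α' β β'
  conv_lhs => rw [hinvol]
  rw [map_smul, LinearMap.smul_apply, map_smul, CDGA.dualAct_dualAct_involPow β' β ha', smul_smul,
    ← sgn_add, hsgn]

end Algebra

/-! ### Functions on a tensor product -/

section TensorForm

variable {k A V : Type*} [Field k] [Ring A] [Algebra k A] [AddCommGroup V] [Module k V]
  (𝒜 : CDGA k A) (𝒱 : DGSpace k V)

/-- The effect of differentiating `φ ⊠ g` along a vector of `A ⊗ V`, on the level of pairs `φ ⊗ g`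
of a linear function on `A` and a formal function on `ΠV`. -/
def contraction : A ⊗[k] V →ₗ[k] Module.End k (Module.Dual k A ⊗[k] Form 𝒱.shift) :=
  ∑ β : ZMod 2, TensorProduct.map₂ (𝒜.dualAct β) (Form.derivₗ 𝒱.shift ∘ₗ 𝒱.shift.proj β)

variable {𝒱} in
theorem contraction_tmul (a : A) {β : ZMod 2} {v : V} (hv : v ∈ 𝒱.shift.part β)
    (φ : Module.Dual k A) (g : Form 𝒱.shift) :
    contraction 𝒜 𝒱 (a ⊗ₜ v) (φ ⊗ₜ g) = 𝒜.dualAct β a φ ⊗ₜ deriv 𝒱.shift v g := by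
  have hsum : contraction 𝒜 𝒱 (a ⊗ₜ v) (φ ⊗ₜ g) =
      ∑ i : ZMod 2, 𝒜.dualAct i a φ ⊗ₜ[k] Form.derivₗ 𝒱.shift (𝒱.shift.proj i v) g := by
    simp [contraction]
  rw [hsum, Fintype.sum_eq_single β fun i hi => ?_]
  · rw [𝒱.shift.proj_self hv, Form.derivₗ_apply]
  · obtain rfl := (by decide : ∀ a b : ZMod 2, a ≠ b → b = a + 1) _ _ hi
    rw [𝒱.shift.proj_other hv, map_zero, LinearMap.zero_apply, TensorProduct.tmul_zero]

/-- The iterated derivatives of `φ ⊠ g` at the origin. -/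
def contractionEval : List (A ⊗[k] V) → Module.Dual k A ⊗[k] Form 𝒱.shift →ₗ[k] k
  | [] => TensorProduct.lift (LinearMap.mk₂ k (fun φ g => φ 1 * g.1 [])
      (fun φ ψ g => by simp [add_mul]) (fun c φ g => by simp [mul_assoc])
      (fun φ g h => by simp [mul_add]) (fun c φ g => by simp [mul_left_comm]))
  | w :: l => contractionEval l ∘ₗ contraction 𝒜 𝒱 w

/-- The list `l` consists of pure tensors `a ⊗ v` with `a ∈ A` and `v ∈ ΠV` homogeneous, their
parities being recorded in `s`. -/
abbrev PureParities (l : List (A × V)) (s : List (ZMod 2 × ZMod 2)) : Prop :=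
  List.Forall₂ (fun x p => x.1 ∈ 𝒜.part p.1 ∧ x.2 ∈ 𝒱.shift.part p.2) l s

variable {𝒜 𝒱} in
theorem PureParities.prod_mem {l : List (A × V)} {s : List (ZMod 2 × ZMod 2)}
    (h : PureParities 𝒜 𝒱 l s) : (l.map Prod.fst).prod ∈ 𝒜.part (s.map Prod.fst).sum := by
  induction h with
  | nil => exact 𝒜.one_mem
  | cons hx _ ih => exact 𝒜.mul_mem _ _ _ hx.1 _ ih

theorem koszul_eq_add (i : ZMod 2) (s : List (ZMod 2 × ZMod 2)) :
    koszul i s = i * (s.map Prod.fst).sum + koszul 0 s := by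
  suffices h : ∀ j, koszul (i + j) s = i * (s.map Prod.fst).sum + koszul j s by
    simpa using h 0
  intro j
  induction s generalizing j with
  | nil => simp [koszul]
  | cons p s ih =>
    simp only [koszul, List.map_cons, List.sum_cons]
    rw [add_assoc, ih]
    ring

variable [CharZero k]

/-- The dg space `Π(A ⊗ V)`. -/
abbrev tensorShift : DGSpace k (A ⊗[k] V) := (𝒜.toDGSpace.tensor 𝒱).shift

theorem tmul_mem_tensorShift {α β : ZMod 2} {a : A} {v : V} (ha : a ∈ 𝒜.part α)
    (hv : v ∈ 𝒱.shift.part β) : a ⊗ₜ[k] v ∈ (tensorShift 𝒜 𝒱).part (α + β) := by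
  have h := tmul_mem_tensorPart 𝒜.toDGSpace 𝒱 ha hv
  rwa [← add_assoc] at h

theorem tensorShift_d_tmul {α : ZMod 2} {a : A} (ha : a ∈ 𝒜.part α) (v : V) :
    (tensorShift 𝒜 𝒱).d (a ⊗ₜ v) = 𝒜.d a ⊗ₜ v + sgn k α • (a ⊗ₜ[k] 𝒱.shift.d v) :=
  tensorD_tmul 𝒜.toDGSpace 𝒱 ha v

theorem tensorShift_part_le {i : ZMod 2} {S : Submodule k (A ⊗[k] V)}
    (h : ∀ α β, α + β = i → ∀ a ∈ 𝒜.part α, ∀ v ∈ 𝒱.shift.part β, a ⊗ₜ[k] v ∈ S) :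
    (tensorShift 𝒜 𝒱).part i ≤ S := by
  refine tensorPart_induction 𝒜.toDGSpace 𝒱 fun α β hαβ a ha v hv => ?_
  have hβ : β + 1 + 1 = β := (by decide : ∀ β : ZMod 2, β + 1 + 1 = β) β
  refine h α (β + 1) (by rw [← add_assoc, hαβ, add_assoc, CharTwo.add_self_eq_zero, add_zero]) a ha
    v ?_
  change v ∈ 𝒱.part (β + 1 + 1)
  rwa [hβ]

variable {𝒜 𝒱} in
theorem Form.apply_cons_congr_of_tmul {f g : Form (tensorShift 𝒜 𝒱)} {l : List (A ⊗[k] V)}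
    (h : ∀ α β, ∀ a ∈ 𝒜.part α, ∀ v ∈ 𝒱.shift.part β,
      (deriv (tensorShift 𝒜 𝒱) (a ⊗ₜ v) f).1 l = (deriv (tensorShift 𝒜 𝒱) (a ⊗ₜ v) g).1 l)
    (w : A ⊗[k] V) : f.1 (w :: l) = g.1 (w :: l) := by
  refine Form.apply_cons_congr_of_span (S := {w | ∃ α β, ∃ a ∈ 𝒜.part α,
    ∃ v ∈ 𝒱.shift.part β, a ⊗ₜ v = w}) ?_ ?_ w
  · rw [eq_top_iff, ← (tensorShift 𝒜 𝒱).span_homogeneous, Submodule.span_le]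
    intro w ⟨i, hw⟩
    refine tensorShift_part_le 𝒜 𝒱 (S := Submodule.span k _)
      (fun α β _ a ha v hv => Submodule.subset_span ?_) hw
    exact ⟨α, β, a, ha, v, hv, rfl⟩
  · rintro _ ⟨α, β, a, ha, v, hv, rfl⟩
    exact h α β a ha v hv

theorem contraction_comm {i j : ZMod 2} {u w : A ⊗[k] V} (hu : u ∈ (tensorShift 𝒜 𝒱).part i)
    (hw : w ∈ (tensorShift 𝒜 𝒱).part j) (T : Module.Dual k A ⊗[k] Form 𝒱.shift) :
    contraction 𝒜 𝒱 w (contraction 𝒜 𝒱 u T) =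
      sgn k (i * j) • contraction 𝒜 𝒱 u (contraction 𝒜 𝒱 w T) := by
  let P := (LinearMap.mul k _).compl₁₂ (contraction 𝒜 𝒱) (contraction 𝒜 𝒱)
  suffices h : P w u = sgn k (i * j) • P u w from LinearMap.congr_fun h T
  have hpure {α β α' β' : ZMod 2} {a a' : A} {v v' : V} (ha : a ∈ 𝒜.part α)
      (hv : v ∈ 𝒱.shift.part β) (ha' : a' ∈ 𝒜.part α') (hv' : v' ∈ 𝒱.shift.part β') :
      P (a' ⊗ₜ v') (a ⊗ₜ v) = sgn k ((α + β) * (α' + β')) • P (a ⊗ₜ v) (a' ⊗ₜ v') := by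
    refine TensorProduct.ext' fun φ g => ?_
    change contraction 𝒜 𝒱 (a' ⊗ₜ v') (contraction 𝒜 𝒱 (a ⊗ₜ v) (φ ⊗ₜ g)) = sgn k _ •
      contraction 𝒜 𝒱 (a ⊗ₜ v) (contraction 𝒜 𝒱 (a' ⊗ₜ v') (φ ⊗ₜ g))
    have hsgn := (by decide : ∀ α α' β β' : ZMod 2,
      β * α' + α * α' + β' * α + β * β' = (α + β) * (α' + β')) α α' β β'
    simp only [contraction_tmul 𝒜 a hv, contraction_tmul 𝒜 a' hv']
    rw [CDGA.dualAct_comm β β' ha ha', Form.deriv_deriv hv hv', TensorProduct.smul_tmul_smul,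
      ← sgn_add, hsgn]
  have hu_pure {α' β' : ZMod 2} {a' : A} {v' : V} (ha' : a' ∈ 𝒜.part α')
      (hv' : v' ∈ 𝒱.shift.part β') : (tensorShift 𝒜 𝒱).part i ≤
        LinearMap.eqLocus (P (a' ⊗ₜ v')) (sgn k (i * (α' + β')) • P.flip (a' ⊗ₜ v')) :=
    tensorShift_part_le 𝒜 𝒱 fun α β hi a ha v hv => hi ▸ hpure ha hv ha' hv'
  have hw_mem : (tensorShift 𝒜 𝒱).part j ≤
      LinearMap.eqLocus (P.flip u) (sgn k (i * j) • P u) :=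
    tensorShift_part_le 𝒜 𝒱 fun α' β' hj a' ha' v' hv' => hj ▸ hu_pure ha' hv' hu
  exact hw_mem hw

theorem contractionEval_mem (T : Module.Dual k A ⊗[k] Form 𝒱.shift) :
    (fun l => contractionEval 𝒜 𝒱 l T) ∈ Form (tensorShift 𝒜 𝒱) := by
  refine ⟨fun l₁ => ?_, fun l₁ => ?_, fun l₁ => ?_⟩
  · induction l₁ generalizing T with
    | nil => intro l₂ u v; simp [contractionEval]
    | cons w _ ih => exact ih (contraction 𝒜 𝒱 w T)
  · induction l₁ generalizing T with
    | nil => intro l₂ c u; simp [contractionEval]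
    | cons w _ ih => exact ih (contraction 𝒜 𝒱 w T)
  · induction l₁ generalizing T with
    | nil =>
      intro l₂ i j u hu v hv
      simp only [List.nil_append, contractionEval, LinearMap.comp_apply]
      rw [contraction_comm 𝒜 𝒱 hu hv, map_smul, smul_eq_mul]
    | cons w _ ih => exact ih (contraction 𝒜 𝒱 w T)

/-- The formal function `φ ⊠ g : (a_1 ⊗ v_1, …, a_n ⊗ v_n) ↦ ± φ (a_1 ⋯ a_n) g (v_1, …, v_n)`
on `Π(A ⊗ V)`. -/
def tensorForm : Module.Dual k A →ₗ[k] Form 𝒱.shift →ₗ[k] Form (tensorShift 𝒜 𝒱) :=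
  TensorProduct.curry
    { toFun := fun T => ⟨fun l => contractionEval 𝒜 𝒱 l T, contractionEval_mem 𝒜 𝒱 T⟩
      map_add' := fun S T => Form.ext fun l => map_add (contractionEval 𝒜 𝒱 l) S T
      map_smul' := fun c T => Form.ext fun l => map_smul (contractionEval 𝒜 𝒱 l) c T }

variable {𝒱}

theorem tensorForm_nil (φ : Module.Dual k A) (g : Form 𝒱.shift) :
    (tensorForm 𝒜 𝒱 φ g).1 [] = φ 1 * g.1 [] := rfl

theorem deriv_tensorForm (a : A) {β : ZMod 2} {v : V} (hv : v ∈ 𝒱.shift.part β)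
    (φ : Module.Dual k A) (g : Form 𝒱.shift) :
    deriv (tensorShift 𝒜 𝒱) (a ⊗ₜ v) (tensorForm 𝒜 𝒱 φ g) =
      tensorForm 𝒜 𝒱 (𝒜.dualAct β a φ) (deriv 𝒱.shift v g) := by
  ext l
  change contractionEval 𝒜 𝒱 l (contraction 𝒜 𝒱 (a ⊗ₜ v) (φ ⊗ₜ g)) = _
  rw [contraction_tmul 𝒜 a hv]
  rfl

theorem AtLeast.tensorForm {n : ℕ} (φ : Module.Dual k A) {g : Form 𝒱.shift}
    (hg : AtLeast n g) : AtLeast n (tensorForm 𝒜 𝒱 φ g) := by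
  intro l hl
  induction l generalizing n φ g with
  | nil => rw [tensorForm_nil, hg [] hl, mul_zero]
  | cons w l ih =>
    refine Form.apply_cons_congr_of_tmul (g := 0) (fun _ β a _ v hv => ?_) w
    rw [deriv_tensorForm 𝒜 a hv, map_zero]
    exact ih (n := n - 1) _ (fun l' hl' => hg (v :: l') (by simp; omega)) (by simp at hl; omega)

theorem involPow_tensorForm (i : ZMod 2) (φ : Module.Dual k A) (g : Form 𝒱.shift) :
    Form.involPow (tensorShift 𝒜 𝒱) i (tensorForm 𝒜 𝒱 φ g) =
      tensorForm 𝒜 𝒱 (φ ∘ₗ 𝒜.involPow i) (Form.involPow 𝒱.shift i g) := by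
  ext l
  induction l generalizing φ g with
  | nil => simp [tensorForm_nil, 𝒜.involPow_one_apply_one, Form.involPow_nil]
  | cons w l ih =>
    refine Form.apply_cons_congr_of_tmul (fun α β a ha v hv => ?_) w
    rw [Form.deriv_involPow i (tmul_mem_tensorShift 𝒜 𝒱 ha hv), deriv_tensorForm 𝒜 a hv,
      deriv_tensorForm 𝒜 a hv, Form.deriv_involPow i hv, CDGA.dualAct_comp_involPow β i ha,
      ← 𝒜.dualAct_apply_comp_involPow]
    simp only [map_smul, LinearMap.smul_apply, Form.smul_apply]
    rw [ih, mul_add, sgn_add, _root_.mul_assoc, mul_left_comm]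

theorem diff_tensorForm (φ : Module.Dual k A) (g : Form 𝒱.shift) :
    diff (tensorShift 𝒜 𝒱) (tensorForm 𝒜 𝒱 φ g) =
      tensorForm 𝒜 𝒱 (φ ∘ₗ 𝒜.involPow 1) (diff 𝒱.shift g) + tensorForm 𝒜 𝒱 (φ ∘ₗ 𝒜.d) g := by
  ext l
  induction l generalizing φ g with
  | nil => simp [Form.diff_nil, tensorForm_nil, 𝒜.d_one]
  | cons w l ih =>
    refine Form.apply_cons_congr_of_tmul (fun α β a ha v hv => ?_) w
    rw [map_add, Form.deriv_diff (tmul_mem_tensorShift 𝒜 𝒱 ha hv), tensorShift_d_tmul 𝒜 𝒱 ha,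
      Form.deriv_add, Form.deriv_smul, deriv_tensorForm 𝒜 a hv,
      deriv_tensorForm 𝒜 a (𝒱.shift.d_mem _ _ hv), deriv_tensorForm 𝒜 (𝒜.d a) hv,
      deriv_tensorForm 𝒜 a hv, deriv_tensorForm 𝒜 a hv, Form.deriv_diff hv,
      CDGA.dualAct_comp_involPow β 1 ha, CDGA.dualAct_comp_d β ha]
    simp only [map_smul, map_add, LinearMap.smul_apply, LinearMap.add_apply, Form.smul_apply,
      Form.add_apply, ih, 𝒜.dualAct_apply_comp_involPow, sgn_add, one_mul]
    ring

theorem tensorForm_one (φ : Module.Dual k A) : tensorForm 𝒜 𝒱 φ 1 = φ 1 • 1 := by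
  ext l
  cases l with
  | nil => simp [tensorForm_nil]
  | cons w l =>
    refine Form.apply_cons_congr_of_tmul (fun _ β a _ v hv => ?_) w
    rw [deriv_tensorForm 𝒜 a hv, Form.deriv_one, map_zero, map_smul, Form.deriv_one, smul_zero]

theorem lin_eq_tensorForm (φ : Module.Dual k A) (x : Module.Dual k V)
    {y : Module.Dual k (A ⊗[k] V)} (h : ∀ a v, y (a ⊗ₜ v) = φ a * x v) :
    lin (tensorShift 𝒜 𝒱) y = tensorForm 𝒜 𝒱 φ (lin 𝒱.shift x) := by
  ext l
  cases l with
  | nil => simp [tensorForm_nil]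
  | cons w l =>
    refine Form.apply_cons_congr_of_tmul (fun _ β a _ v hv => ?_) w
    rw [deriv_tensorForm 𝒜 a hv, Form.deriv_lin, Form.deriv_lin, h, map_smul, tensorForm_one,
      𝒜.dualAct_apply, 𝒜.involPow_one_apply_one, mul_one, smul_smul, mul_comm]

variable {𝒜}

theorem tensorForm_apply (φ : Module.Dual k A) (g : Form 𝒱.shift) {l : List (A × V)}
    {s : List (ZMod 2 × ZMod 2)} (h : PureParities 𝒜 𝒱 l s) :
    (tensorForm 𝒜 𝒱 φ g).1 (l.map fun x => x.1 ⊗ₜ[k] x.2) =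
      sgn k (koszul 0 s) * (φ (l.map Prod.fst).prod * g.1 (l.map Prod.snd)) := by
  induction h generalizing φ g with
  | nil => simp [tensorForm_nil, koszul]
  | @cons x p l s hx hs ih =>
    simp only [List.map_cons, List.prod_cons, Form.apply_cons, koszul, zero_mul, zero_add]
    rw [deriv_tensorForm 𝒜 x.1 hx.2, ih, 𝒜.dualAct_apply,
      𝒜.involPow_of_mem _ (PureParities.prod_mem hs), koszul_eq_add p.2, sgn_add, mul_smul_comm,
      map_smul, smul_eq_mul]
    ring

theorem Form.ext_of_pure {f g : Form (tensorShift 𝒜 𝒱)}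
    (h : ∀ l s, PureParities 𝒜 𝒱 l s →
      f.1 (l.map fun x => x.1 ⊗ₜ[k] x.2) = g.1 (l.map fun x => x.1 ⊗ₜ[k] x.2)) : f = g := by
  ext l
  induction l generalizing f g with
  | nil => exact h [] [] .nil
  | cons w l ih =>
    exact Form.apply_cons_congr_of_tmul (fun α β a ha v hv => ih fun l s hs =>
      h ((a, v) :: l) ((α, β) :: s) (.cons ⟨ha, hv⟩ hs)) w

end TensorForm

/-! ### The supertrace of multiplication operators -/

section MulSupertrace

variable {k A : Type*} [Field k] [Ring A] [Algebra k A]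

theorem HomogeneousFrame.trace_eq_sum {W ι : Type*} [AddCommGroup W] [Module k W]
    [FiniteDimensional k W] [Fintype ι] {𝒲 : DGSpace k W} (B : HomogeneousFrame 𝒲 ι)
    (T : W →ₗ[k] W) : LinearMap.trace k W T = ∑ i, B.x i (T (B.e i)) := by
  have hT : T = ∑ i, dualTensorHom k W W (B.x i ⊗ₜ T (B.e i)) := by
    refine LinearMap.ext fun w => ?_
    conv_lhs => rw [← B.sum_eq w]
    simp
  conv_lhs => rw [hT]
  simp

/-- The linear function `a ↦ Tr (x ↦ a x)` on `A`. -/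
def CDGA.mulSupertrace (𝒜 : CDGA k A) : Module.Dual k A :=
  LinearMap.trace k A ∘ₗ LinearMap.lcomp k A 𝒜.invol ∘ₗ LinearMap.mul k A

variable (𝒜 : CDGA k A)

theorem CDGA.mulSupertrace_apply (a : A) :
    𝒜.mulSupertrace a = 𝒜.supertrace (LinearMap.mulLeft k a) := rfl

theorem CDGA.unimodular_iff : 𝒜.Unimodular ↔ 𝒜.mulSupertrace = 0 :=
  ⟨fun h => LinearMap.ext h, fun h => LinearMap.congr_fun h⟩

variable {ι : Type*} [Fintype ι]

variable {𝒜} in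
theorem HomogeneousFrame.mulSupertrace_apply [FiniteDimensional k A]
    (B : HomogeneousFrame 𝒜.toDGSpace ι) (a : A) :
    𝒜.mulSupertrace a = ∑ i, sgn k (B.p i) * B.x i (a * B.e i) := by
  rw [𝒜.mulSupertrace_apply, DGSpace.supertrace, B.trace_eq_sum]
  simp [𝒜.invol_of_mem (B.e_mem _)]

variable [FiniteDimensional k A]

theorem CDGA.mulSupertrace_of_odd {a : A} (ha : a ∈ 𝒜.part 1) : 𝒜.mulSupertrace a = 0 := by
  rw [𝒜.stdFrame.mulSupertrace_apply]
  refine Finset.sum_eq_zero fun i _ => ?_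
  have hmem := 𝒜.mul_mem _ _ a ha _ (𝒜.stdFrame.e_mem i)
  rw [add_comm] at hmem
  rw [𝒜.stdFrame.x_eq_zero i _ hmem, mul_zero]

theorem CDGA.mulSupertrace_comp_involPow (i : ZMod 2) :
    𝒜.mulSupertrace ∘ₗ 𝒜.involPow i = 𝒜.mulSupertrace := by
  refine 𝒜.hom_ext fun j a ha => ?_
  rw [LinearMap.comp_apply, 𝒜.involPow_of_mem i ha, map_smul]
  rcases zmod_two_cases j with rfl | rfl
  · rw [mul_zero, sgn_zero, one_smul]
  · rw [𝒜.mulSupertrace_of_odd ha, smul_zero]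

/-- The multiplication by `d a`, for odd `a`, is the supercommutator of `d` and the multiplication
by `a`. -/
theorem CDGA.mulSupertrace_comp_d : 𝒜.mulSupertrace ∘ₗ 𝒜.d = 0 := by
  refine 𝒜.hom_ext fun j a ha => ?_
  rw [LinearMap.comp_apply, LinearMap.zero_apply]
  rcases zmod_two_cases j with rfl | rfl
  · exact 𝒜.mulSupertrace_of_odd (by simpa using 𝒜.d_mem 0 a ha)
  · have hcomm : LinearMap.mulLeft k (𝒜.d a) =
        𝒜.d ∘ₗ LinearMap.mulLeft k a + LinearMap.mulLeft k a ∘ₗ 𝒜.d := by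
      refine LinearMap.ext fun b => ?_
      simp [𝒜.leibniz 1 a ha]
    have hinvol : 𝒜.d ∘ₗ 𝒜.invol = -(𝒜.invol ∘ₗ 𝒜.d) := by
      refine LinearMap.ext fun b => ?_
      simpa [𝒜.involPow_one] using 𝒜.d_involPow 1 b
    rw [𝒜.mulSupertrace_apply, DGSpace.supertrace, hcomm, LinearMap.add_comp, map_add,
      LinearMap.comp_assoc 𝒜.invol 𝒜.d, hinvol, LinearMap.comp_neg, map_neg,
      LinearMap.comp_assoc, LinearMap.trace_comp_comm', LinearMap.comp_assoc, add_neg_cancel]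

variable {𝒜} in
theorem HomogeneousFrame.mulSupertrace_eq_sum_dualAct (B : HomogeneousFrame 𝒜.toDGSpace ι)
    (β : ZMod 2) : 𝒜.mulSupertrace = ∑ i, 𝒜.dualAct β (B.e i) (B.x i ∘ₗ 𝒜.involPow 1) := by
  refine 𝒜.hom_ext fun r b hb => ?_
  rw [B.mulSupertrace_apply, LinearMap.sum_apply]
  refine Finset.sum_congr rfl fun i _ => ?_
  have hodd (hr : r = 1) : B.x i (B.e i * b) = 0 :=
    B.x_eq_zero i _ (hr ▸ 𝒜.mul_mem _ _ _ (B.e_mem i) _ hb)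
  rw [𝒜.dualAct_apply, B.x_comp_involPow, LinearMap.smul_apply, smul_eq_mul, one_mul,
    𝒜.involPow_of_mem _ hb, 𝒜.mul_eq_involPow_mul hb, 𝒜.involPow_of_mem _ (B.e_mem i)]
  rcases zmod_two_cases r with rfl | rfl
  · simp
  · simp [hodd rfl]

end MulSupertrace

/-! ### Vector fields on a tensor product -/

section TensorField

variable {k A V : Type*} [Field k] [CharZero k] [Ring A] [Algebra k A] [AddCommGroup V]
  [Module k V] {𝒜 : CDGA k A} {𝒱 : DGSpace k V} {ι κ : Type*} [Fintype ι] [Fintype κ]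

/-- The tensor product of a frame of `A` and a frame of `ΠV`. -/
def HomogeneousFrame.tensor (B : HomogeneousFrame 𝒜.toDGSpace ι)
    (C : HomogeneousFrame 𝒱.shift κ) : HomogeneousFrame (tensorShift 𝒜 𝒱) (ι × κ) where
  p a := B.p a.1 + C.p a.2
  e a := B.e a.1 ⊗ₜ C.e a.2
  x a := LinearMap.mul' k k ∘ₗ TensorProduct.map (B.x a.1) (C.x a.2)
  e_mem a := tmul_mem_tensorShift 𝒜 𝒱 (B.e_mem a.1) (C.e_mem a.2)
  x_eq_zero a w hw := by
    refine tensorShift_part_le 𝒜 𝒱 (S := LinearMap.ker (LinearMap.mul' k k ∘ₗ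
      TensorProduct.map (B.x a.1) (C.x a.2))) (fun α β h u hu v hv => ?_) hw
    simp only [LinearMap.mem_ker, LinearMap.comp_apply, TensorProduct.map_tmul,
      LinearMap.mul'_apply]
    rcases (by decide : ∀ α β p q : ZMod 2, α + β = p + q + 1 → α = p + 1 ∨ β = q + 1)
      α β _ _ h with rfl | rfl
    · rw [B.x_eq_zero a.1 u hu, zero_mul]
    · rw [C.x_eq_zero a.2 v hv, mul_zero]
  sum_eq w := by
    induction w using TensorProduct.induction_on with
    | zero => simp
    | tmul u v =>
      conv_rhs => rw [← B.sum_eq u, ← C.sum_eq v]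
      simp only [TensorProduct.sum_tmul, TensorProduct.tmul_sum, Fintype.sum_prod_type,
        LinearMap.comp_apply, TensorProduct.map_tmul, LinearMap.mul'_apply,
        TensorProduct.smul_tmul_smul]
      exact Finset.sum_comm
    | add u v hu hv => simp only [map_add, add_smul, Finset.sum_add_distrib, hu, hv]

theorem HomogeneousFrame.lin_tensor (B : HomogeneousFrame 𝒜.toDGSpace ι)
    (C : HomogeneousFrame 𝒱.shift κ) (a : ι × κ) :
    lin (tensorShift 𝒜 𝒱) ((B.tensor C).x a) =
      tensorForm 𝒜 𝒱 (B.x a.1) (lin 𝒱.shift (C.x a.2)) :=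
  lin_eq_tensorForm 𝒜 _ _ fun _ _ => rfl

/-- Both sides are the image of `T`, viewed as a tensor in `A^* ⊗ A`. -/
theorem HomogeneousFrame.sum_tensorForm_comp_mul (B : HomogeneousFrame 𝒜.toDGSpace ι)
    (T : A →ₗ[k] A) (Ψ : A →ₗ[k] Module.Dual k A) (g h : Form 𝒱.shift) :
    ∑ i, tensorForm 𝒜 𝒱 (B.x i ∘ₗ T) g * tensorForm 𝒜 𝒱 (Ψ (B.e i)) h =
      ∑ i, tensorForm 𝒜 𝒱 (B.x i) g * tensorForm 𝒜 𝒱 (Ψ (T (B.e i))) h := by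
  have hx : ∀ i, B.x i ∘ₗ T = ∑ j, B.x i (T (B.e j)) • B.x j := fun i =>
    B.dual_eq_sum (B.x i ∘ₗ T)
  have hΨ : ∀ j, Ψ (T (B.e j)) = ∑ i, B.x i (T (B.e j)) • Ψ (B.e i) := fun j => by
    conv_lhs => rw [← B.sum_eq (T (B.e j))]
    simp only [map_sum, map_smul]
  simp only [hx, hΨ, map_sum, map_smul, LinearMap.sum_apply, LinearMap.smul_apply,
    Finset.sum_mul, Finset.mul_sum, smul_mul_assoc, mul_smul_comm]
  exact Finset.sum_comm

theorem HomogeneousFrame.deriv_sum_tensorForm_mul (B : HomogeneousFrame 𝒜.toDGSpace ι)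
    (Ψ : A →ₗ[k] Module.Dual k A) {q : ZMod 2} {g : Form 𝒱.shift} (hg : HasParity q g)
    (h : Form 𝒱.shift) {α β : ZMod 2} {a : A} {v : V} (ha : a ∈ 𝒜.part α)
    (hv : v ∈ 𝒱.shift.part β) :
    deriv (tensorShift 𝒜 𝒱) (a ⊗ₜ v)
        (∑ i, tensorForm 𝒜 𝒱 (B.x i) g * tensorForm 𝒜 𝒱 (Ψ (B.e i)) h) =
      ∑ i, tensorForm 𝒜 𝒱 (B.x i) (deriv 𝒱.shift v g) *
          tensorForm 𝒜 𝒱 (Ψ (a * 𝒜.involPow β (B.e i))) h +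
        sgn k ((α + β) * q) • ∑ i, tensorForm 𝒜 𝒱 (B.x i) g *
          tensorForm 𝒜 𝒱 (𝒜.dualAct β a (Ψ (𝒜.involPow (α + β) (B.e i)))) (deriv 𝒱.shift v h) := by
  have hleft := B.sum_tensorForm_comp_mul (LinearMap.mulLeft k a ∘ₗ 𝒜.involPow β) Ψ
    (deriv 𝒱.shift v g) h
  have hright := B.sum_tensorForm_comp_mul (𝒜.involPow (α + β)) (𝒜.dualAct β a ∘ₗ Ψ) g
    (deriv 𝒱.shift v h)
  simp only [LinearMap.comp_apply, LinearMap.mulLeft_apply] at hleft hright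
  simp only [map_sum, Form.deriv_mul (tmul_mem_tensorShift 𝒜 𝒱 ha hv), Finset.sum_add_distrib,
    deriv_tensorForm 𝒜 a hv, involPow_tensorForm, hg.involPow, map_smul, smul_mul_assoc,
    ← Finset.smul_sum]
  rw [← hleft, ← hright]
  rfl

theorem HomogeneousFrame.tensorForm_mul (B : HomogeneousFrame 𝒜.toDGSpace ι)
    (φ : Module.Dual k A) {q : ZMod 2} {g : Form 𝒱.shift} (hg : HasParity q g)
    (h : Form 𝒱.shift) :
    tensorForm 𝒜 𝒱 φ (g * h) =
      ∑ i, tensorForm 𝒜 𝒱 (B.x i) g * tensorForm 𝒜 𝒱 (𝒜.dualAct q (B.e i) φ) h := by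
  ext l
  induction l generalizing φ q g h with
  | nil =>
    have hφ : φ 1 = ∑ i, B.x i 1 * φ (B.e i) := by
      conv_lhs => rw [← B.sum_eq 1]
      simp only [map_sum, map_smul, smul_eq_mul]
    simp only [Submodule.coe_sum, Finset.sum_apply, Form.mul_nil, tensorForm_nil,
      𝒜.dualAct_apply, 𝒜.involPow_one_apply_one, mul_one, hφ, Finset.sum_mul]
    exact Finset.sum_congr rfl fun i _ => by ring
  | cons w l ih =>
    refine Form.apply_cons_congr_of_tmul (fun α β a ha v hv => ?_) w
    have hderiv := B.deriv_sum_tensorForm_mul ((𝒜.dualAct q).flip φ) hg h ha hv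
    simp only [LinearMap.flip_apply, 𝒜.dualAct_mul_involPow, CDGA.dualAct_dualAct_involPow β q ha,
      map_smul, LinearMap.smul_apply, mul_smul_comm, ← Finset.smul_sum] at hderiv
    have hsgn := (by decide : ∀ α β q : ZMod 2, (α + β) * q + q * α = β * q) α β q
    rw [hderiv, smul_smul, ← sgn_add, hsgn, deriv_tensorForm 𝒜 a hv, Form.deriv_mul hv,
      hg.involPow, smul_mul_assoc, map_add, map_smul]
    simp only [Form.add_apply, Form.smul_apply, ih _ (hg.deriv hv), ih _ hg, add_comm q β]

variable (B : HomogeneousFrame 𝒜.toDGSpace ι) (C : HomogeneousFrame 𝒱.shift κ) {p : ZMod 2}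
  {D : Form 𝒱.shift →ₗ[k] Form 𝒱.shift}

/-- The vector field on `Π(A ⊗ V)` induced by a vector field `D` of parity `p` on `ΠV`; it maps
`φ ⊠ g` to `± φ ⊠ D g`. -/
def HomogeneousFrame.tensorField (p : ZMod 2) (D : Form 𝒱.shift →ₗ[k] Form 𝒱.shift) :
    Form (tensorShift 𝒜 𝒱) →ₗ[k] Form (tensorShift 𝒜 𝒱) :=
  (B.tensor C).field fun a =>
    tensorForm 𝒜 𝒱 (B.x a.1 ∘ₗ 𝒜.involPow p) (D (lin 𝒱.shift (C.x a.2)))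

theorem IsSuperderivation.tensorField (hD : IsSuperderivation p D) :
    IsSuperderivation p (B.tensorField C p D) := by
  refine (B.tensor C).isSuperderivation_field fun a => ?_
  have hsgn := (by decide : ∀ a b p : ZMod 2,
    1 * (b + p) + (p * a + 1 * a) = a + b + p + p * a) (B.p a.1) (C.p a.2) p
  rw [hasParity_iff, involPow_tensorForm, (hD.hasParity (C.hasParity_lin a.2)).involPow,
    B.x_comp_involPow, LinearMap.smul_comp, B.x_comp_involPow]
  simp only [map_smul, LinearMap.smul_apply, smul_smul, ← sgn_add, HomogeneousFrame.tensor, hsgn]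

theorem HomogeneousFrame.tensorField_tensorForm (hD : IsSuperderivation p D)
    (φ : Module.Dual k A) (g : Form 𝒱.shift) :
    B.tensorField C p D (tensorForm 𝒜 𝒱 φ g) = tensorForm 𝒜 𝒱 (φ ∘ₗ 𝒜.involPow p) (D g) := by
  rw [HomogeneousFrame.tensorField, HomogeneousFrame.field_apply, C.apply_eq_sum hD g, map_sum,
    Fintype.sum_prod_type, Finset.sum_comm]
  refine Finset.sum_congr rfl fun i _ => ?_
  rw [B.tensorForm_mul _ (hD.hasParity (C.hasParity_lin i))]
  refine Finset.sum_congr rfl fun j _ => ?_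
  have hp : C.p i + p + p = C.p i := by rw [add_assoc, CharTwo.add_self_eq_zero, add_zero]
  simp only [HomogeneousFrame.tensor]
  rw [deriv_tensorForm 𝒜 _ (C.e_mem i), B.x_comp_involPow,
    CDGA.dualAct_comp_involPow _ _ (B.e_mem j), hp]
  simp only [map_smul, LinearMap.smul_apply, smul_mul_assoc, mul_smul_comm]

theorem HomogeneousFrame.divergence_tensorField [FiniteDimensional k A] [FiniteDimensional k V]
    (hD : IsSuperderivation 1 D) :
    divergence 1 (B.tensorField C 1 D) = tensorForm 𝒜 𝒱 𝒜.mulSupertrace (divergence 1 D) := by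
  rw [(B.tensor C).divergence_eq_sum, C.divergence_eq_sum, map_sum, Fintype.sum_prod_type,
    Finset.sum_comm]
  refine Finset.sum_congr rfl fun i _ => ?_
  rw [B.mulSupertrace_eq_sum_dualAct (C.p i), map_sum, LinearMap.sum_apply]
  refine Finset.sum_congr rfl fun j _ => ?_
  rw [B.lin_tensor, B.tensorField_tensorForm C hD]
  exact deriv_tensorForm 𝒜 _ (C.e_mem i) _ _

end TensorField

/-! ### Pullback along even linear maps -/

section Pullback

variable {k W W' : Type*} [Field k] [AddCommGroup W] [Module k W] [AddCommGroup W'] [Module k W']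
  {𝒲 : DGSpace k W} {𝒲' : DGSpace k W'}

/-- The pullback of formal functions along a linear map that preserves parity. -/
def Form.pullback (T : W →ₗ[k] W') (hT : ∀ i, ∀ w ∈ 𝒲.part i, T w ∈ 𝒲'.part i) :
    Form 𝒲' →ₗ[k] Form 𝒲 where
  toFun f := ⟨fun l => f.1 (l.map T), by
    obtain ⟨hadd, hsmul, hswap⟩ := f.2
    refine ⟨fun l₁ l₂ u v => ?_, fun l₁ l₂ c u => ?_, fun l₁ l₂ i j u hu v hv => ?_⟩
    · simp only [List.map_append, List.map_cons, map_add, hadd]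
    · simp only [List.map_append, List.map_cons, map_smul, hsmul]
    · simp only [List.map_append, List.map_cons]
      exact hswap _ _ i j _ (hT i u hu) _ (hT j v hv)⟩
  map_add' _ _ := rfl
  map_smul' _ _ := rfl

variable {T : W →ₗ[k] W'} {hT : ∀ i, ∀ w ∈ 𝒲.part i, T w ∈ 𝒲'.part i}

theorem Form.pullback_nil (f : Form 𝒲') : (Form.pullback T hT f).1 [] = f.1 [] := rfl

theorem Form.deriv_pullback (w : W) (f : Form 𝒲') :
    deriv 𝒲 w (Form.pullback T hT f) = Form.pullback T hT (deriv 𝒲' (T w) f) := rfl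

theorem Form.involPow_pullback (i : ZMod 2) (f : Form 𝒲') :
    Form.involPow 𝒲 i (Form.pullback T hT f) = Form.pullback T hT (Form.involPow 𝒲' i f) := by
  ext l
  induction l generalizing f with
  | nil => simp only [Form.involPow_nil, Form.pullback_nil]
  | cons w l ih =>
    refine Form.apply_cons_congr (fun j w hw => ?_) w
    simp only [Form.deriv_involPow i hw, Form.deriv_pullback, Form.deriv_involPow i (hT j w hw),
      map_smul, Form.smul_apply, ih]

theorem HasParity.pullback {q : ZMod 2} {f : Form 𝒲'} (hf : HasParity q f) :
    HasParity q (Form.pullback T hT f) := fun l s hs hq =>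
  hf (l.map T) s (List.forall₂_map_left_iff.mpr (hs.imp fun w i hw => hT i w hw)) hq

theorem Form.pullback_mul (f g : Form 𝒲') :
    Form.pullback T hT (f * g) = Form.pullback T hT f * Form.pullback T hT g := by
  ext l
  induction l generalizing f g with
  | nil => simp only [Form.mul_nil, Form.pullback_nil]
  | cons w l ih =>
    refine Form.apply_cons_congr (fun j w hw => ?_) w
    simp only [Form.deriv_pullback, Form.deriv_mul hw, Form.deriv_mul (hT j w hw), map_add,
      Form.add_apply, ih, Form.involPow_pullback]

theorem Form.pullback_diff (hd : ∀ w, T (𝒲.d w) = 𝒲'.d (T w)) (f : Form 𝒲') :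
    Form.pullback T hT (diff 𝒲' f) = diff 𝒲 (Form.pullback T hT f) := by
  ext l
  induction l generalizing f with
  | nil => simp only [Form.diff_nil, Form.pullback_nil]
  | cons w l ih =>
    refine Form.apply_cons_congr (fun j w hw => ?_) w
    simp only [Form.deriv_pullback, Form.deriv_diff hw, Form.deriv_diff (hT j w hw), map_add,
      map_smul, Form.add_apply, Form.smul_apply, ih, hd]

end Pullback

section Restriction

variable {k A V : Type*} [Field k] [CharZero k] [Ring A] [Algebra k A] [AddCommGroup V]
  [Module k V] {𝒜 : CDGA k A} {e : A}

theorem mk_mem_tensorShift {𝒱 : DGSpace k V} (he : e ∈ 𝒜.part 0) (i : ZMod 2) (v : V)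
    (hv : v ∈ 𝒱.shift.part i) : TensorProduct.mk k A V e v ∈ (tensorShift 𝒜 𝒱).part i := by
  simpa using tmul_mem_tensorShift 𝒜 𝒱 he hv

/-- The restriction of functions on `Π(A ⊗ V)` to `e ⊗ V`, for an even element `e`. -/
def restrict (he : e ∈ 𝒜.part 0) (𝒱 : DGSpace k V) :
    Form (tensorShift 𝒜 𝒱) →ₗ[k] Form 𝒱.shift :=
  Form.pullback (TensorProduct.mk k A V e) (mk_mem_tensorShift he)

variable {𝒱 : DGSpace k V} (he : e ∈ 𝒜.part 0)

theorem deriv_restrict (v : V) (f : Form (tensorShift 𝒜 𝒱)) :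
    deriv 𝒱.shift v (restrict he 𝒱 f) = restrict he 𝒱 (deriv (tensorShift 𝒜 𝒱) (e ⊗ₜ v) f) := rfl

theorem restrict_mul (f g : Form (tensorShift 𝒜 𝒱)) :
    restrict he 𝒱 (f * g) = restrict he 𝒱 f * restrict he 𝒱 g := Form.pullback_mul f g

theorem restrict_tensorForm_apply (φ : Module.Dual k A) (g : Form 𝒱.shift) (l : List V) :
    (restrict he 𝒱 (tensorForm 𝒜 𝒱 φ g)).1 l = φ (e ^ l.length) * g.1 l := by
  have hpow (n : ℕ) : e ^ n ∈ 𝒜.part 0 := by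
    induction n with
    | zero => exact pow_zero e ▸ 𝒜.one_mem
    | succ n ih => simpa [pow_succ] using 𝒜.mul_mem _ _ _ ih _ he
  induction l generalizing φ g with
  | nil => rw [List.length_nil, pow_zero]; rfl
  | cons v l ih =>
    refine Form.apply_cons_congr (g := φ (e ^ (l.length + 1)) • g) (fun j v hv => ?_) v
    rw [deriv_restrict, deriv_tensorForm 𝒜 e hv, ih, 𝒜.dualAct_apply,
      𝒜.involPow_of_mem j (hpow _), mul_zero, sgn_zero, one_smul, ← pow_succ', map_smul,
      Form.smul_apply]

theorem restrict_tensorForm (hee : IsIdempotentElem e) (φ : Module.Dual k A) {g : Form 𝒱.shift}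
    (hg : AtLeast 1 g) : restrict he 𝒱 (tensorForm 𝒜 𝒱 φ g) = φ e • g := by
  ext l
  rw [restrict_tensorForm_apply, Form.smul_apply]
  rcases l with _ | ⟨v, l⟩
  · rw [hg [] one_pos, mul_zero, mul_zero]
  · rw [List.length_cons, IsIdempotentElem.pow_succ_eq _ hee]

theorem tensorForm_eq_zero_iff {φ : Module.Dual k A} {g : Form 𝒱.shift} (hg : AtLeast 1 g) :
    tensorForm 𝒜 𝒱 φ g = 0 ↔ φ = 0 ∨ g = 0 := by
  refine ⟨fun h => or_iff_not_imp_left.mpr fun hφ => ?_, ?_⟩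
  · obtain ⟨a, ha⟩ := DFunLike.ne_iff.mp hφ
    ext l
    rcases l with _ | ⟨v, l⟩
    · exact hg [] one_pos
    refine Form.apply_cons_congr (g := 0) (fun β v hv => ?_) v
    have hzero : φ a * (deriv 𝒱.shift v g).1 l = 0 := by
      have hrestrict := restrict_tensorForm_apply 𝒜.one_mem (𝒜.dualAct β a φ)
        (deriv 𝒱.shift v g) l
      rw [← deriv_tensorForm 𝒜 a hv, h, map_zero, map_zero, one_pow, 𝒜.dualAct_apply,
        𝒜.involPow_one_apply_one, mul_one] at hrestrict
      exact hrestrict.symm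
    exact (mul_eq_zero.mp hzero).resolve_left ha
  · rintro (rfl | rfl)
    · rw [map_zero, LinearMap.zero_apply]
    · rw [map_zero]

theorem restrict_diff (hee : IsIdempotentElem e) (f : Form (tensorShift 𝒜 𝒱)) :
    restrict he 𝒱 (diff (tensorShift 𝒜 𝒱) f) = diff 𝒱.shift (restrict he 𝒱 f) := by
  refine Form.pullback_diff (fun v => ?_) f
  rw [TensorProduct.mk_apply, TensorProduct.mk_apply, tensorShift_d_tmul 𝒜 𝒱 he,
    𝒜.d_idempotent he hee, TensorProduct.zero_tmul, zero_add, sgn_zero, one_smul]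

theorem restrict_tensorField {ι κ : Type*} [Fintype ι] [Fintype κ]
    (B : HomogeneousFrame 𝒜.toDGSpace ι) (C : HomogeneousFrame 𝒱.shift κ) {p : ZMod 2}
    {D : Form 𝒱.shift →ₗ[k] Form 𝒱.shift} (hD : IsSuperderivation p D)
    (hD_atLeast : ∀ y, AtLeast 1 (D (lin 𝒱.shift y))) (hee : IsIdempotentElem e)
    (f : Form (tensorShift 𝒜 𝒱)) :
    restrict he 𝒱 (B.tensorField C p D f) = D (restrict he 𝒱 f) := by
  rw [HomogeneousFrame.tensorField, HomogeneousFrame.field_apply, map_sum, C.apply_eq_sum hD,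
    Fintype.sum_prod_type, Finset.sum_comm]
  refine Finset.sum_congr rfl fun i _ => ?_
  have hderiv : deriv 𝒱.shift (C.e i) (restrict he 𝒱 f) =
      ∑ j, B.x j e • restrict he 𝒱 (deriv (tensorShift 𝒜 𝒱) (B.e j ⊗ₜ C.e i) f) := by
    have htmul : e ⊗ₜ[k] C.e i = ∑ j, B.x j e • (B.e j ⊗ₜ[k] C.e i) := by
      conv_lhs => rw [← B.sum_eq e, TensorProduct.sum_tmul]
      simp only [TensorProduct.smul_tmul']
    simp only [deriv_restrict, htmul, Form.deriv_sum, map_sum, Form.deriv_smul, map_smul]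
  rw [hderiv, Finset.mul_sum]
  refine Finset.sum_congr rfl fun j _ => ?_
  have heven : B.x j (𝒜.involPow p e) = B.x j e := by
    rw [𝒜.involPow_of_mem p he, mul_zero, sgn_zero, one_smul]
  rw [restrict_mul, restrict_tensorForm he hee _ (hD_atLeast _),
    LinearMap.comp_apply, heven, smul_mul_assoc, mul_smul_comm]
  rfl

end Restriction

/-! ### The tensor product of a cdga and an `L_∞` algebra -/

section LInfty

variable {k V : Type*} [Field k] [AddCommGroup V] [Module k V] {𝒱 : DGSpace k V} (L : LInfty 𝒱)

theorem LInfty.maurerCartan_apply [CharZero k] (f : Form 𝒱.shift) :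
    diff 𝒱.shift (L.m f) + L.m (diff 𝒱.shift f) + L.m (L.m f) = 0 := by
  have h := LinearMap.congr_fun L.maurerCartan f
  simp only [bracket, mul_one, sgn_one, neg_neg, one_smul, LinearMap.add_apply,
    LinearMap.comp_apply, LinearMap.smul_apply, LinearMap.zero_apply] at h
  rw [← h]
  module

theorem LInfty.isSuperderivation [CharZero k] : IsSuperderivation 1 L.m :=
  L.isDerivation.isSuperderivation

variable [FiniteDimensional k V]

theorem LInfty.divergence_atLeast : AtLeast 1 (divergence 1 L.m) := by
  rw [𝒱.shift.stdFrame.divergence_eq_sum]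
  exact AtLeast.sum _ fun i _ => (L.atLeast _).deriv _

variable [CharZero k]

theorem LInfty.strictlyUnimodular_iff : L.StrictlyUnimodular ↔ divergence 1 L.m = 0 := by
  have hparity : HasParity 0 (0 : Form 𝒱.shift) := fun l s _ _ => rfl
  simp [LInfty.StrictlyUnimodular, LInfty.IsUnimodularWith, hparity]

variable {A : Type*} [Ring A] [Algebra k A] [FiniteDimensional k A] (𝒜 : CDGA k A)

/-- The vector field of the `L_∞` structure on `A ⊗ V`. -/
def tensorVectorField : Form (tensorShift 𝒜 𝒱) →ₗ[k] Form (tensorShift 𝒜 𝒱) :=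
  𝒜.stdFrame.tensorField 𝒱.shift.stdFrame 1 L.m

theorem isSuperderivation_tensorVectorField : IsSuperderivation 1 (tensorVectorField L 𝒜) :=
  L.isSuperderivation.tensorField _ _

theorem tensorVectorField_tensorForm (φ : Module.Dual k A) (g : Form 𝒱.shift) :
    tensorVectorField L 𝒜 (tensorForm 𝒜 𝒱 φ g) =
      tensorForm 𝒜 𝒱 (φ ∘ₗ 𝒜.involPow 1) (L.m g) :=
  HomogeneousFrame.tensorField_tensorForm _ _ L.isSuperderivation φ g

theorem tensorVectorField_maurerCartan :
    bracket 1 1 (diff (tensorShift 𝒜 𝒱)) (tensorVectorField L 𝒜) +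
      (1 / 2 : k) • bracket 1 1 (tensorVectorField L 𝒜) (tensorVectorField L 𝒜) = 0 := by
  have hm := isSuperderivation_tensorVectorField L 𝒜
  refine (𝒜.stdFrame.tensor 𝒱.shift.stdFrame).eq_zero_of_map_lin
    ((isSuperderivation_diff.bracket_one_one hm).add ((hm.bracket_one_one hm).smul _)) fun i => ?_
  rw [HomogeneousFrame.lin_tensor]
  generalize 𝒜.stdFrame.x i.1 = φ
  generalize lin 𝒱.shift (𝒱.shift.stdFrame.x i.2) = g
  have hinvol : (φ ∘ₗ 𝒜.involPow 1) ∘ₗ 𝒜.involPow 1 = φ := by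
    ext b
    simp [𝒜.involPow_involPow, CharTwo.add_self_eq_zero]
  have hd : (φ ∘ₗ 𝒜.involPow 1) ∘ₗ 𝒜.d = -((φ ∘ₗ 𝒜.d) ∘ₗ 𝒜.involPow 1) := by
    ext b
    simp [𝒜.d_involPow]
  have hmaurerCartan := congrArg (tensorForm 𝒜 𝒱 φ) (L.maurerCartan_apply g)
  simp only [map_add, map_zero] at hmaurerCartan
  simp only [bracket, mul_one, sgn_one, neg_neg, one_smul, LinearMap.add_apply,
    LinearMap.comp_apply, LinearMap.smul_apply, tensorVectorField_tensorForm, diff_tensorForm,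
    map_add, hinvol, hd, map_neg, LinearMap.neg_apply]
  rw [← hmaurerCartan]
  module

/-- The `L_∞` structure on `A ⊗ V`. -/
def tensorLInfty : LInfty (𝒜.toDGSpace.tensor 𝒱) where
  m := tensorVectorField L 𝒜
  isDerivation := (isSuperderivation_tensorVectorField L 𝒜).isDerivation
  atLeast y := by
    rw [tensorVectorField, HomogeneousFrame.tensorField, HomogeneousFrame.field_lin]
    exact AtLeast.sum _ fun i _ => ((L.atLeast _).tensorForm 𝒜 _).smul _
  maurerCartan := tensorVectorField_maurerCartan L 𝒜

theorem tensorLInfty_isTensorProduct : IsTensorProduct 𝒜 L (tensorLInfty L 𝒜) := by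
  intro l s hs
  let B := 𝒜.stdFrame.tensor 𝒱.shift.stdFrame
  suffices hcoord : ∀ i, B.x i (taylor (tensorLInfty L 𝒜).m (l.map fun x => x.1 ⊗ₜ[k] x.2)) =
      B.x i (sgn k (koszul 1 s) •
        ((l.map Prod.fst).prod ⊗ₜ[k] taylor L.m (l.map Prod.snd))) by
    rw [← B.sum_eq (taylor _ _), ← B.sum_eq (_ • _)]
    simp only [hcoord]
  intro i
  have hx : B.x i ((l.map Prod.fst).prod ⊗ₜ[k] taylor L.m (l.map Prod.snd)) =
    𝒜.stdFrame.x i.1 (l.map Prod.fst).prod *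
      𝒱.shift.stdFrame.x i.2 (taylor L.m (l.map Prod.snd)) := rfl
  rw [lin_apply_taylor, HomogeneousFrame.lin_tensor]
  change (tensorVectorField L 𝒜 _).1 _ = _
  rw [tensorVectorField_tensorForm, tensorForm_apply _ _ hs, LinearMap.comp_apply,
    𝒜.involPow_of_mem 1 (PureParities.prod_mem hs), map_smul, map_smul, hx, koszul_eq_add 1,
    sgn_add, ← lin_apply_taylor]
  simp only [smul_eq_mul]
  ring

variable {L 𝒜} in
theorem IsTensorProduct.unique {M M' : LInfty (𝒜.toDGSpace.tensor 𝒱)}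
    (hM : IsTensorProduct 𝒜 L M) (hM' : IsTensorProduct 𝒜 L M') : M' = M := by
  refine LInfty.ext ((tensorShift 𝒜 𝒱).stdFrame.ext_of_map_lin M'.isSuperderivation
    M.isSuperderivation fun i => Form.ext_of_pure fun l s hs => ?_)
  rw [← lin_apply_taylor, ← lin_apply_taylor, hM l s hs, hM' l s hs]

theorem divergence_tensorLInfty : divergence 1 (tensorLInfty L 𝒜).m =
    tensorForm 𝒜 𝒱 𝒜.mulSupertrace (divergence 1 L.m) :=
  HomogeneousFrame.divergence_tensorField _ _ L.isSuperderivation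

theorem tensorLInfty_strictlyUnimodular_iff :
    (tensorLInfty L 𝒜).StrictlyUnimodular ↔ L.StrictlyUnimodular ∨ 𝒜.Unimodular := by
  rw [LInfty.strictlyUnimodular_iff, LInfty.strictlyUnimodular_iff, 𝒜.unimodular_iff,
    divergence_tensorLInfty, tensorForm_eq_zero_iff L.divergence_atLeast, or_comm]

variable {L} in
theorem LInfty.AdmitsUnimodularLift.tensorLInfty (h : L.AdmitsUnimodularLift) :
    (tensorLInfty L 𝒜).AdmitsUnimodularLift := by
  obtain ⟨f, hf, h⟩ := h
  refine ⟨tensorForm 𝒜 𝒱 𝒜.mulSupertrace f, ?_, ?_⟩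
  · rw [hasParity_iff, involPow_tensorForm, 𝒜.mulSupertrace_comp_involPow, hf.involPow, mul_zero,
      sgn_zero, one_smul, one_smul]
  · change _ + _ + tensorVectorField L 𝒜 _ = 0
    rw [divergence_tensorLInfty, tensorVectorField_tensorForm, diff_tensorForm,
      𝒜.mulSupertrace_comp_involPow, 𝒜.mulSupertrace_comp_d, map_zero, LinearMap.zero_apply,
      add_zero, ← map_smul, ← map_add, ← map_add, h, map_zero]

variable {L 𝒜} in
theorem LInfty.AdmitsUnimodularLift.of_tensorLInfty
    (h : (SuperLInfty.tensorLInfty L 𝒜).AdmitsUnimodularLift) {e : A} (he : e ∈ 𝒜.part 0)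
    (hee : IsIdempotentElem e) (htrace : 𝒜.mulSupertrace e ≠ 0) : L.AdmitsUnimodularLift := by
  obtain ⟨F, hF, h⟩ := h
  refine ⟨(𝒜.mulSupertrace e)⁻¹ • restrict he 𝒱 F, .smul _ hF.pullback, ?_⟩
  have hm : restrict he 𝒱 ((SuperLInfty.tensorLInfty L 𝒜).m F) = L.m (restrict he 𝒱 F) :=
    restrict_tensorField he _ _ L.isSuperderivation (fun y => (L.atLeast y).mono one_le_two) hee F
  have hrestrict := congrArg (fun f => (𝒜.mulSupertrace e)⁻¹ • restrict he 𝒱 f) h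
  simp only [map_add, map_smul, map_zero, smul_zero, divergence_tensorLInfty, hm,
    restrict_tensorForm he hee _ L.divergence_atLeast] at hrestrict
  change (𝒜.mulSupertrace e)⁻¹ • (restrict he 𝒱 (diff (tensorShift 𝒜 𝒱) F) + _ + _) = 0
    at hrestrict
  rw [restrict_diff he hee] at hrestrict
  rw [← hrestrict]
  simp only [map_smul, smul_add, smul_smul]
  rw [mul_left_comm, inv_mul_cancel₀ htrace, mul_one]

end LInfty

/-! ### Traces and idempotents -/

section Idempotents

open Polynomial

theorem charpoly_dvd_pow_card {R n : Type*} [CommRing R] [Fintype n] [DecidableEq n]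
    {M : Matrix n n R} {p : R[X]} (hp : aeval M p = 0) : M.charpoly ∣ p ^ Fintype.card n := by
  let m : Algebra.adjoin R {M} := ⟨M, Algebra.self_mem_adjoin_singleton R M⟩
  have hroot : (p.map (algebraMap R (Algebra.adjoin R {M}))).IsRoot m := by
    rw [IsRoot, eval_map_algebraMap]
    exact Subtype.ext ((aeval_algHom_apply (Algebra.adjoin R {M}).val m p).symm.trans hp)
  obtain ⟨q, hq⟩ := dvd_iff_isRoot.mpr hroot
  have hfactor : p • (1 : Matrix n n R[X]) = M.charmatrix *
      matPolyEquiv.symm (q.map (Algebra.adjoin R {M}).val.toRingHom) := by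
    apply (matPolyEquiv (R := R) (n := n)).injective
    rw [map_mul, matPolyEquiv_smul_one, Matrix.matPolyEquiv_charmatrix, AlgEquiv.apply_symm_apply,
      ← (Algebra.adjoin R {M}).val.comp_algebraMap, ← map_map, hq]
    simp [m]
  have hdet := congrArg Matrix.det hfactor
  rw [Matrix.det_smul, Matrix.det_one, mul_one, Matrix.det_mul] at hdet
  exact ⟨_, hdet⟩

theorem natDegree_mul_trace {K M : Type*} [Field K] [AddCommGroup M] [Module K M]
    [FiniteDimensional K M] {T : Module.End K M} {p : K[X]} (hp : Irreducible p) (hmonic : p.Monic)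
    {n : ℕ} (hT : aeval T (p ^ n) = 0) :
    p.natDegree * LinearMap.trace K M T = -p.nextCoeff * Module.finrank K M := by
  let b := Module.finBasis K M
  have hdvd : T.charpoly ∣ p ^ (n * Fintype.card (Fin (Module.finrank K M))) := by
    rw [pow_mul, ← T.charpoly_toMatrix b]
    refine charpoly_dvd_pow_card ?_
    change aeval (LinearMap.toMatrixAlgEquiv b T) (p ^ n) = 0
    rw [aeval_algHom_apply, hT, map_zero]
  obtain ⟨m, -, hassoc⟩ := (dvd_prime_pow hp.prime _).mp hdvd
  have hcharpoly := eq_of_monic_of_associated T.charpoly_monic (hmonic.pow m) hassoc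
  rw [LinearMap.trace_eq_matrix_trace K b, Matrix.trace_eq_neg_charpoly_nextCoeff,
    LinearMap.charpoly_toMatrix, ← T.charpoly_natDegree, hcharpoly, hmonic.nextCoeff_pow,
    natDegree_pow, nsmul_eq_mul]
  push_cast
  ring

variable {K B : Type*} [Field K] [CommRing B] [Algebra K B]

/-- The trace form of a module `M` over a commutative `K`-algebra `B`: the linear function sending
`b` to the trace of the action of `b` on `M`. -/
def moduleTrace (K B M : Type*) [Field K] [CommRing B] [Algebra K B] [AddCommGroup M] [Module K M]
    [Module B M] [IsScalarTower K B M] : B →ₗ[K] K :=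
  LinearMap.trace K M ∘ₗ (Algebra.lsmul K K M).toLinearMap

/-- The idempotents `e` of `B` for which `a` acts on `e B` with a power of an irreducible polynomial
as its annihilating polynomial. -/
def primaryIdempotents (K : Type*) {B : Type*} [Field K] [CommRing B] [Algebra K B] (a : B) :
    Set B :=
  {e | IsIdempotentElem e ∧
    ∃ (p : K[X]) (n : ℕ), Irreducible p ∧ p.Monic ∧ aeval a (p ^ n) * e = 0}

theorem mem_span_primaryIdempotents (a : B) {μ : K[X]} (hμ : μ ≠ 0) {e : B}
    (he : IsIdempotentElem e) (h : aeval a μ * e = 0) :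
    e ∈ Submodule.span K (primaryIdempotents K a) := by
  induction μ using UniqueFactorizationMonoid.induction_on_coprime generalizing e with
  | h0 => exact absurd rfl hμ
  | h1 hunit =>
    rw [((hunit.map (aeval a)).mul_right_eq_zero).mp h]
    exact zero_mem _
  | @hpr p n hprime =>
    have hlead : p.leadingCoeff ≠ 0 := leadingCoeff_ne_zero.mpr hprime.ne_zero
    have hunit : IsUnit (C p.leadingCoeff⁻¹) := isUnit_C.mpr (inv_ne_zero hlead).isUnit
    refine Submodule.subset_span ⟨he, _, n, (irreducible_mul_isUnit hunit).mpr hprime.irreducible,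
      monic_mul_leadingCoeff_inv hprime.ne_zero, ?_⟩
    rw [mul_pow, map_mul, mul_right_comm, h, zero_mul]
  | @hcp x y hxy hx hy =>
    -- If `u x + v y = 1`, then `e` is the sum of the idempotents `u(a) x(a) e` and `v(a) y(a) e`.
    obtain ⟨u, v, huv⟩ := hxy.isCoprime
    have hbezout := congrArg (aeval a) huv
    simp only [map_add, map_mul, map_one] at hbezout h
    have hux : IsIdempotentElem (aeval a u * aeval a x * e) := by
      rw [IsIdempotentElem] at he ⊢
      linear_combination (aeval a u * aeval a x * e) * hbezout +
        (aeval a u * aeval a x) ^ 2 * he - aeval a u * aeval a v * h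
    have hvy : IsIdempotentElem (aeval a v * aeval a y * e) := by
      rw [IsIdempotentElem] at he ⊢
      linear_combination (aeval a v * aeval a y * e) * hbezout +
        (aeval a v * aeval a y) ^ 2 * he - aeval a u * aeval a v * h
    have hsum : e = aeval a u * aeval a x * e + aeval a v * aeval a y * e := by
      linear_combination -e * hbezout
    rw [hsum]
    exact add_mem (hy (right_ne_zero_of_mul hμ) hux (by linear_combination aeval a u * h))
      (hx (left_ne_zero_of_mul hμ) hvy (by linear_combination aeval a v * h))

theorem one_mem_span_primaryIdempotents {a : B} (ha : IsIntegral K a) :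
    1 ∈ Submodule.span K (primaryIdempotents K a) :=
  mem_span_primaryIdempotents a (minpoly.ne_zero ha) .one (by rw [minpoly.aeval, zero_mul])

variable (M : Type*) [AddCommGroup M] [Module K M] [Module B M] [IsScalarTower K B M]
  [FiniteDimensional K M]

theorem natDegree_mul_moduleTrace {p : K[X]} (hp : Irreducible p) (hmonic : p.Monic) {n : ℕ}
    {a e : B} (he : IsIdempotentElem e) (h : aeval a (p ^ n) * e = 0) :
    p.natDegree * moduleTrace K B M (a * e) = -p.nextCoeff * moduleTrace K B M e := by
  let N : Submodule B M := LinearMap.range (LinearMap.lsmul B M e)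
  have hmem : ∀ x ∈ N, e • x = x := by
    rintro _ ⟨y, rfl⟩
    rw [LinearMap.lsmul_apply, smul_smul, he]
  have hproj : LinearMap.IsProj (N.restrictScalars K) (Algebra.lsmul K K M e) :=
    ⟨fun x => ⟨x, rfl⟩, hmem⟩
  have : FiniteDimensional K N := inferInstanceAs (FiniteDimensional K (N.restrictScalars K))
  have hrange : ∀ x, Algebra.lsmul K K M (a * e) x ∈ N.restrictScalars K := fun x =>
    ⟨a • x, by simp [smul_smul]⟩
  have htrace : LinearMap.trace K N (Algebra.lsmul K K N a) =
      LinearMap.trace K M (Algebra.lsmul K K M (a * e)) := by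
    rw [← LinearMap.trace_restrict_eq_of_forall_mem _ _ hrange]
    refine congrArg (LinearMap.trace K N) (LinearMap.ext fun x => Subtype.ext ?_)
    change a • (x : M) = (a * e) • (x : M)
    rw [mul_smul, hmem x x.2]
  have hpow : aeval (Algebra.lsmul K K N a) (p ^ n) = 0 := by
    rw [aeval_algHom_apply]
    ext x
    change aeval a (p ^ n) • (x : M) = 0
    rw [← hmem x x.2, smul_smul, h, zero_smul]
  change _ * LinearMap.trace K M (Algebra.lsmul K K M (a * e)) =
    _ * LinearMap.trace K M (Algebra.lsmul K K M e)
  rw [← htrace, hproj.trace]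
  exact natDegree_mul_trace hp hmonic hpow

variable {M} in
theorem moduleTrace_eq_of_idempotent [CharZero K] {N : Type*} [AddCommGroup N] [Module K N]
    [Module B N] [IsScalarTower K B N] [FiniteDimensional K N] [Algebra.IsIntegral K B]
    (h : ∀ e : B, IsIdempotentElem e → moduleTrace K B M e = moduleTrace K B N e) :
    moduleTrace K B M = moduleTrace K B N := by
  refine LinearMap.ext fun a => ?_
  suffices hspan : Submodule.span K (primaryIdempotents K a) ≤ LinearMap.eqLocus
      (moduleTrace K B M ∘ₗ LinearMap.mulLeft K a) (moduleTrace K B N ∘ₗ LinearMap.mulLeft K a) by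
    simpa using hspan (one_mem_span_primaryIdempotents (Algebra.IsIntegral.isIntegral a))
  refine Submodule.span_le.mpr ?_
  rintro e ⟨he, p, n, hp, hmonic, hpe⟩
  have hdegree : (p.natDegree : K) ≠ 0 := Nat.cast_ne_zero.mpr hp.natDegree_pos.ne'
  refine mul_left_cancel₀ hdegree ?_
  simp only [LinearMap.comp_apply, LinearMap.mulLeft_apply]
  rw [natDegree_mul_moduleTrace M hp hmonic he hpe, natDegree_mul_moduleTrace N hp hmonic he hpe,
    h e he]

end Idempotents

section EvenPart

variable {k A : Type*} [Field k] [Ring A] [Algebra k A] (𝒜 : CDGA k A)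

/-- The even part of a cdga, as a subalgebra. -/
def CDGA.even : Subalgebra k A where
  carrier := 𝒜.part 0
  add_mem' := (𝒜.part 0).add_mem
  mul_mem' {a b} ha hb := by simpa using 𝒜.mul_mem 0 0 a ha b hb
  algebraMap_mem' c := by
    rw [Algebra.algebraMap_eq_smul_one]
    exact Submodule.smul_mem _ _ 𝒜.one_mem

instance CDGA.evenCommRing : CommRing 𝒜.even :=
  { (inferInstance : Ring 𝒜.even) with
    mul_comm := fun a b => Subtype.ext (by simpa using 𝒜.mul_comm 0 0 a a.2 b b.2) }

/-- The part of parity `i` of a cdga, as a module over the even part. -/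
def CDGA.partModule (i : ZMod 2) : Submodule 𝒜.even A where
  __ := 𝒜.part i
  smul_mem' a b hb := by simpa using! 𝒜.mul_mem 0 i a a.2 b hb

variable [FiniteDimensional k A]

instance CDGA.partModule_finite (i : ZMod 2) : FiniteDimensional k (𝒜.partModule i) :=
  inferInstanceAs (FiniteDimensional k (𝒜.part i))

theorem CDGA.mulSupertrace_eq_sub (a : 𝒜.even) : 𝒜.mulSupertrace (a : A) =
    moduleTrace k 𝒜.even (𝒜.partModule 0) a - moduleTrace k 𝒜.even (𝒜.partModule 1) a := by
  have hpart (i : ZMod 2) : moduleTrace k 𝒜.even (𝒜.partModule i) a =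
      LinearMap.trace k A (LinearMap.mulLeft k (a : A) ∘ₗ 𝒜.proj i) := by
    have hmem : ∀ x, (LinearMap.mulLeft k (a : A) ∘ₗ 𝒜.proj i) x ∈ 𝒜.part i := fun x => by
      simpa using 𝒜.mul_mem 0 i a a.2 _ (𝒜.proj_mem i x)
    rw [← LinearMap.trace_restrict_eq_of_forall_mem _ _ hmem]
    refine congrArg (LinearMap.trace k (𝒜.part i)) (LinearMap.ext fun x => Subtype.ext ?_)
    change (a : A) * x = a * 𝒜.proj i x
    rw [𝒜.proj_self x.2]
  rw [hpart, hpart, 𝒜.mulSupertrace_apply, DGSpace.supertrace, DGSpace.invol, LinearMap.comp_sub,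
    map_sub]

theorem CDGA.exists_idempotent [CharZero k] (h : ¬𝒜.Unimodular) :
    ∃ e ∈ 𝒜.part 0, IsIdempotentElem e ∧ 𝒜.mulSupertrace e ≠ 0 := by
  by_contra! hidempotent
  refine h (𝒜.unimodular_iff.mpr (𝒜.hom_ext fun i a ha => ?_))
  rcases zmod_two_cases i with rfl | rfl
  · have htrace : moduleTrace k 𝒜.even (𝒜.partModule 0) =
        moduleTrace k 𝒜.even (𝒜.partModule 1) := by
      refine moduleTrace_eq_of_idempotent fun e he => sub_eq_zero.mp ?_
      rw [← 𝒜.mulSupertrace_eq_sub]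
      exact hidempotent e e.2 (congrArg Subtype.val he)
    rw [𝒜.mulSupertrace_eq_sub ⟨a, ha⟩, htrace, sub_self, LinearMap.zero_apply]
  · exact 𝒜.mulSupertrace_of_odd ha

variable {V : Type*} [CharZero k] [AddCommGroup V] [Module k V] [FiniteDimensional k V]
  {𝒱 : DGSpace k V} (L : LInfty 𝒱)

theorem tensorLInfty_admitsUnimodularLift_iff :
    (tensorLInfty L 𝒜).AdmitsUnimodularLift ↔ L.AdmitsUnimodularLift ∨ 𝒜.Unimodular := by
  refine ⟨fun h => or_iff_not_imp_right.mpr fun hA => ?_, ?_⟩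
  · obtain ⟨e, he, hee, htrace⟩ := 𝒜.exists_idempotent hA
    exact h.of_tensorLInfty he hee htrace
  · rintro (h | h)
    · exact h.tensorLInfty 𝒜
    · exact ⟨0, (tensorLInfty_strictlyUnimodular_iff L 𝒜).mpr (.inr h)⟩

end EvenPart

end SuperLInfty

end

theorem theorem7p7 {k : Type*} [Field k] [CharZero k]
    {A : Type*} [Ring A] [Algebra k A] [FiniteDimensional k A] (𝒜 : SuperLInfty.CDGA k A)
    {V : Type*} [AddCommGroup V] [Module k V] [FiniteDimensional k V]
    (𝒱 : SuperLInfty.DGSpace k V) (L : SuperLInfty.LInfty 𝒱) :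
    ∃ M : SuperLInfty.LInfty (𝒜.toDGSpace.tensor 𝒱),
      SuperLInfty.IsTensorProduct 𝒜 L M ∧
      (∀ M' : SuperLInfty.LInfty (𝒜.toDGSpace.tensor 𝒱),
        SuperLInfty.IsTensorProduct 𝒜 L M' → M' = M) ∧
      (M.StrictlyUnimodular ↔ L.StrictlyUnimodular ∨ 𝒜.Unimodular) ∧
      (M.AdmitsUnimodularLift ↔ L.AdmitsUnimodularLift ∨ 𝒜.Unimodular) :=
  ⟨SuperLInfty.tensorLInfty L 𝒜, SuperLInfty.tensorLInfty_isTensorProduct L 𝒜,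
    fun _ hM' => SuperLInfty.IsTensorProduct.unique
      (SuperLInfty.tensorLInfty_isTensorProduct L 𝒜) hM',
    SuperLInfty.tensorLInfty_strictlyUnimodular_iff L 𝒜,
    SuperLInfty.tensorLInfty_admitsUnimodularLift_iff 𝒜 L⟩
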